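/- Let $n\ge 1$, let $\Omega\subset\mathbb{R}^n$ be a bounded domain with smooth boundary, and let $0<\alpha<1$. Let $\gamma=(\gamma^{ij}(s,x,p))$ be a conductivity, that is, a matrix-valued function on $\mathbb{R}\times\overline\Omega\times\mathbb{R}^n$ of class $C^{2,\alpha}$ (second derivatives $\alpha$-Hölder on compact sets), which is symmetric and satisfies, for every $s\in\mathbb{R}$, $\gamma^{ij}(s,x,0)\xi_i\xi_j\ge C(s)|\xi|^2$ for all $x\in\overline\Omega$, $\xi\in\mathbb{R}^n$, with some $C(s)>0$. For $f\in C^{2,\alpha}(\partial\Omega)$ consider solutions $u\in C^{2,\alpha}(\overline\Omega)$ of $$\partial_i\big(\gamma^{ij}(u,x,\nabla u)\,\partial_j u\big)=0\ \text{ in }\Omega,\qquad u=f\ \text{ on }\partial\Omega. \tag{1}$$ Say that (1) is solvable near a constant $\lambda\in\mathbb{R}$ with radius $\delta>0$ if there is an open neighbourhood $U$ of $\lambda$ in $C^{2,\alpha}(\overline\Omega)$ such that for every $f$ in the closed ball $B(\lambda,\delta)=\{f:\|f-\lambda\|_{C^{2,\alpha}(\partial\Omega)}\le\delta\}$ problem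 (1) has exactly one solution $u^f$ in $U$, and $f\mapsto u^f$ is continuous from $B(\lambda,\delta)$ to $C^{2,\alpha}(\overline\Omega)$. The Dirichlet-to-Neumann map $N_\gamma$ is the map whose domain is the union of all balls $B(\lambda,\delta)$ such that (1) is solvable near $\lambda$ with radius $\delta$, and which sends $f$ to the $(n-1)$-form $$N_\gamma(f)=\gamma^{ij}(u^f,x,\nabla u^f)\,\partial_j u^f\,\nu_i\quad\text{on }\partial\Omega,\qquad \nu_i=\iota^*\big(\partial_i\lrcorner\, dx^1\wedge\dots\wedge dx^n\big),$$ where $\iota:\partial\Omega\to\overline\Omega$ is the inclusion. Let $\Phi:\overline\Omega\to\overline\Omega$ be a $C^{3,\alpha}$ diffeomorphism with $\Phi|_{\partial\Omega}=\mathrm{id}$. Write $D\Phi=(\partial_i\Phi^k)_{ik}$, with $i$ the row index, and define the gauge transform of $\gamma$ by $$(H_\Phi\gamma)(s,y,p)=\frac{D\Phi(x)^{T}\,\gamma\big(s,x,D\Phi(x)p\big)\,D\Phi(x)}{|\det D\Phi(x)|},\qquad x=\Phi^{-1}(y).$$ Then $N_{H_\Phi\gamma}=N_\gamma$: the two maps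 have the same domain and the same values on it. -/

import Mathlib

open Set
open scoped NNReal ENNReal Matrix ContDiff

noncomputable section

namespace QuasilinearDN

/-- Euclidean space of dimension `n = d + 1 ≥ 1`. -/
abbrev Eu (d : ℕ) : Type := EuclideanSpace ℝ (Fin (d + 1))

/-- The coordinate vector `∂_i`. -/
def coordVec {d : ℕ} (i : Fin (d + 1)) : Eu d := EuclideanSpace.single i (1 : ℝ)

/-- The boundary of `Ω` is smooth: near each boundary point, `Ω` is the negativity set of a
smooth function whose differential does not vanish at that point. -/
def HasSmoothBoundary {d : ℕ} (Ω : Set (Eu d)) : Prop :=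
  ∀ x₀ ∈ frontier Ω, ∃ V ∈ nhds x₀, ∃ ρ : Eu d → ℝ,
    ContDiff ℝ ∞ ρ ∧ fderiv ℝ ρ x₀ ≠ 0 ∧ ∀ x ∈ V, (x ∈ Ω ↔ ρ x < 0)

/-- A bounded domain with smooth boundary. -/
structure IsSmoothBoundedDomain {d : ℕ} (Ω : Set (Eu d)) : Prop where
  isOpen : IsOpen Ω
  isConnected : IsConnected Ω
  isBounded : Bornology.IsBounded Ω
  smoothBoundary : HasSmoothBoundary Ω

/-! ### Hölder spaces on `Ω̄` and on `∂Ω` -/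

section Holder

variable {E F : Type*} [NormedAddCommGroup E] [NormedSpace ℝ E]
  [NormedAddCommGroup F] [NormedSpace ℝ F]

/-- The norm `∑_{j ≤ k} sup_s |D^j u| + [D^k u]_{α; s}` of `C^{k,α}(s)`, with values in `[0, ∞]`. -/
def holderNorm (k : ℕ) (α : ℝ≥0) (s : Set E) (u : E → F) : ℝ≥0∞ :=
  (∑ j ∈ Finset.range (k + 1), ⨆ x ∈ s, ‖iteratedFDerivWithin ℝ j u s x‖ₑ) +
    eHolderNorm α (s.domRestrict (iteratedFDerivWithin ℝ k u s))

/-- `u ∈ C^{k,α}(s)`; used with `s = Ω̄`. Only the values of `u` on `s` matter. -/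
def MemHolder (k : ℕ) (α : ℝ≥0) (s : Set E) (u : E → F) : Prop :=
  ContDiffOn ℝ k u s ∧ holderNorm k α s u < ⊤

/-- `u` is of class `C^{k,α}` on the possibly non-compact set `s`: it is `C^k` and its `k`-th
derivative is `α`-Hölder on compact subsets of `s`. -/
def MemHolderLoc (k : ℕ) (α : ℝ≥0) (s : Set E) (u : E → F) : Prop :=
  ContDiffOn ℝ k u s ∧
    ∀ K : Set E, IsCompact K → K ⊆ s →
      ∃ C : ℝ≥0, HolderOnWith C α (iteratedFDerivWithin ℝ k u s) K

end Holder

/-- The norm of `C^{2,α}(∂Ω)`: the infimum of the `C^{2,α}(Ω̄)` norms of the extensions of `f`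
to `Ω̄`; it is infinite exactly when `f` is not in `C^{2,α}(∂Ω)`. -/
def boundaryNorm {d : ℕ} (Ω : Set (Eu d)) (α : ℝ≥0) (f : frontier Ω → ℝ) : ℝ≥0∞ :=
  ⨅ (u : Eu d → ℝ) (_ : MemHolder 2 α (closure Ω) u) (_ : ∀ x : frontier Ω, u x = f x),
    holderNorm 2 α (closure Ω) u

/-- The closed ball of radius `δ` in `C^{2,α}(∂Ω)` around the constant `c`. -/
def boundaryBall {d : ℕ} (Ω : Set (Eu d)) (α : ℝ≥0) (c δ : ℝ) : Set (frontier Ω → ℝ) :=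
  {f | boundaryNorm Ω α (fun x => f x - c) ≤ ENNReal.ofReal δ}

/-! ### Conductivities and the boundary value problem -/

/-- Coefficients `γ^{ij}(s, x, p)`, as functions `γ s x p i j`. -/
abbrev Coeff (d : ℕ) : Type := ℝ → Eu d → Eu d → Matrix (Fin (d + 1)) (Fin (d + 1)) ℝ

/-- A quasilinear anisotropic conductivity: of class `C^{2,α}` in `(s, x, p) ∈ ℝ × Ω̄ × ℝⁿ`,
symmetric, and elliptic at `p = 0`, uniformly in `x`. -/
structure IsConductivity {d : ℕ} (Ω : Set (Eu d)) (α : ℝ≥0) (γ : Coeff d) : Prop where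
  regular : ∀ i j, MemHolderLoc 2 α ((univ : Set ℝ) ×ˢ (closure Ω ×ˢ (univ : Set (Eu d))))
    (fun z : ℝ × Eu d × Eu d => γ z.1 z.2.1 z.2.2 i j)
  symm : ∀ s, ∀ x ∈ closure Ω, ∀ p, (γ s x p).IsSymm
  elliptic : ∀ s : ℝ, ∃ C : ℝ, 0 < C ∧ ∀ x ∈ closure Ω, ∀ ξ : Eu d,
    C * ∑ i, ξ i ^ 2 ≤ ∑ i, ∑ j, γ s x 0 i j * ξ i * ξ j

/-- The flux `γ^{ij}(u(x), x, ∇u(x)) ∂_j u(x)`, `x ∈ Ω̄`; at boundary points the gradient is taken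
from within `Ω̄`. -/
def flux {d : ℕ} (Ω : Set (Eu d)) (γ : Coeff d) (u : Eu d → ℝ) (x : Eu d) (i : Fin (d + 1)) : ℝ :=
  ∑ j, γ (u x) x (gradientWithin u (closure Ω) x) i j * gradientWithin u (closure Ω) x j

/-- `u ∈ C^{2,α}(Ω̄)` solves `∂_i(γ^{ij}(u, x, ∇u) ∂_j u) = 0` in `Ω`, `u = f` on `∂Ω`. -/
structure IsSolution {d : ℕ} (Ω : Set (Eu d)) (α : ℝ≥0) (γ : Coeff d) (f : frontier Ω → ℝ)
    (u : Eu d → ℝ) : Prop where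
  regular : MemHolder 2 α (closure Ω) u
  differentiable : ∀ x ∈ Ω, ∀ i, DifferentiableAt ℝ (fun y => flux Ω γ u y i) x
  equation : ∀ x ∈ Ω, ∑ i, fderiv ℝ (fun y => flux Ω γ u y i) x (coordVec i) = 0
  boundary : ∀ x : frontier Ω, u x = f x

/-- `U` is open for the topology of `C^{2,α}(Ω̄)`. -/
def IsHolderOpen {d : ℕ} (Ω : Set (Eu d)) (α : ℝ≥0) (U : Set (Eu d → ℝ)) : Prop :=
  ∀ u ∈ U, MemHolder 2 α (closure Ω) u → ∃ ε : ℝ, 0 < ε ∧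
    ∀ v, MemHolder 2 α (closure Ω) v →
      holderNorm 2 α (closure Ω) (v - u) < ENNReal.ofReal ε → v ∈ U

/-- The problem is solvable near the constant `c` for data in the ball of radius `δ` around `c`,
with solution operator `S`: for `f` in this ball, `S f` is the only solution with boundary value
`f` in the `C^{2,α}(Ω̄)`-neighbourhood `U` of the constant function `c`, and `S` is continuous from
the ball to `C^{2,α}(Ω̄)`. -/
structure IsSolutionOperator {d : ℕ} (Ω : Set (Eu d)) (α : ℝ≥0) (γ : Coeff d) (c δ : ℝ)
    (U : Set (Eu d → ℝ)) (S : (frontier Ω → ℝ) → (Eu d → ℝ)) : Prop where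
  radius_pos : 0 < δ
  isOpen : IsHolderOpen Ω α U
  const_mem : (fun _ => c) ∈ U
  mem : ∀ f ∈ boundaryBall Ω α c δ, S f ∈ U
  isSolution : ∀ f ∈ boundaryBall Ω α c δ, IsSolution Ω α γ f (S f)
  unique : ∀ f ∈ boundaryBall Ω α c δ, ∀ v ∈ U, IsSolution Ω α γ f v → EqOn v (S f) (closure Ω)
  continuous : ∀ f ∈ boundaryBall Ω α c δ, ∀ ε : ℝ, 0 < ε → ∃ η : ℝ, 0 < η ∧
    ∀ g ∈ boundaryBall Ω α c δ, boundaryNorm Ω α (g - f) < ENNReal.ofReal η →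
      holderNorm 2 α (closure Ω) (S g - S f) < ENNReal.ofReal ε

/-! ### The Dirichlet-to-Neumann map -/

/-- The tangent space `T_x ∂Ω`, as a subspace of `ℝⁿ`. -/
def boundaryTangent {d : ℕ} (Ω : Set (Eu d)) (x : Eu d) : Submodule ℝ (Eu d) :=
  Submodule.span ℝ (tangentConeAt ℝ (frontier Ω) x)

/-- Differential forms of degree `n - 1` on `∂Ω` (with no regularity imposed). -/
abbrev BoundaryForm {d : ℕ} (Ω : Set (Eu d)) : Type :=
  (x : frontier Ω) → (boundaryTangent Ω (x : Eu d)) [⋀^Fin d]→ₗ[ℝ] ℝ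

/-- The volume form `dx¹ ∧ ⋯ ∧ dxⁿ`. -/
def volForm (d : ℕ) : (Eu d) [⋀^Fin (d + 1)]→ₗ[ℝ] ℝ :=
  (EuclideanSpace.basisFun (Fin (d + 1)) ℝ).toBasis.det

/-- The form `ν_i = ι^*(∂_i ⌟ dx¹ ∧ ⋯ ∧ dxⁿ)` on `∂Ω`, `ι` being the inclusion of `∂Ω`. -/
def nu {d : ℕ} (Ω : Set (Eu d)) (i : Fin (d + 1)) : BoundaryForm Ω :=
  fun x => ((volForm d).curryLeft (coordVec i)).compLinearMap (boundaryTangent Ω (x : Eu d)).subtype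

/-- The form `γ^{ij}(u, x, ∇u) ∂_j u ν_i` on `∂Ω`. -/
def conormalForm {d : ℕ} (Ω : Set (Eu d)) (γ : Coeff d) (u : Eu d → ℝ) : BoundaryForm Ω :=
  fun x => ∑ i, flux Ω γ u (x : Eu d) i • nu Ω i x

/-- `σ` is the Neumann datum of the solution `u^f` near some constant `c`, where `f` lies in a ball
around `c` on which the problem is solvable near `c`. -/
def IsNeumannDatum {d : ℕ} (Ω : Set (Eu d)) (α : ℝ≥0) (γ : Coeff d) (f : frontier Ω → ℝ)
    (σ : BoundaryForm Ω) : Prop :=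
  ∃ (c δ : ℝ) (U : Set (Eu d → ℝ)) (S : (frontier Ω → ℝ) → (Eu d → ℝ)),
    IsSolutionOperator Ω α γ c δ U S ∧ f ∈ boundaryBall Ω α c δ ∧ σ = conormalForm Ω γ (S f)

/-- The Dirichlet-to-Neumann map `N_γ : f ↦ γ^{ij}(u^f, x, ∇u^f) ∂_j u^f ν_i`, a partial map on
the functions on `∂Ω`. It is defined on the union of the balls of `C^{2,α}(∂Ω)` around constants
`c` on which the problem is solvable near `c`. On bounded smooth domains, the continuity of the
solution operators, the openness of `U` and the convexity of the balls make `u^f` independent of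
the ball, of `U` and of `c`, so that the Neumann datum is unique as soon as it exists. -/
def dnMap {d : ℕ} (Ω : Set (Eu d)) (α : ℝ≥0) (γ : Coeff d) :
    (frontier Ω → ℝ) →. BoundaryForm Ω :=
  fun f => ⟨∃! σ, IsNeumannDatum Ω α γ f σ, fun h => h.choose⟩

/-! ### The gauge transform -/

/-- `Φ` is a `C^{3,α}` diffeomorphism of `Ω̄` onto itself. -/
structure IsHolderDiffeo {d : ℕ} (Ω : Set (Eu d)) (α : ℝ≥0) (Φ : PartialEquiv (Eu d) (Eu d)) :
    Prop where
  source_eq : Φ.source = closure Ω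
  target_eq : Φ.target = closure Ω
  regular : MemHolder 3 α (closure Ω) Φ
  regular_symm : MemHolder 3 α (closure Ω) Φ.symm

/-- The matrix `DΦ(x) = (∂_i Φ^k(x))_{ik}`, with `i` the row index, so that
`∇(v ∘ Φ) = DΦ ((∇v) ∘ Φ)` for gradients as column vectors. -/
def jacobian {d : ℕ} (Ω : Set (Eu d)) (Φ : Eu d → Eu d) (x : Eu d) :
    Matrix (Fin (d + 1)) (Fin (d + 1)) ℝ :=
  Matrix.of fun i k => fderivWithin ℝ Φ (closure Ω) x (coordVec i) k

/-- The gauge transform `(H_Φ K)(s, y, p) = |det DΦ(x)|⁻¹ DΦ(x)ᵀ K(s, x, DΦ(x) p) DΦ(x)` with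
`x = Φ⁻¹(y)`. -/
def gaugeTransform {d : ℕ} (Ω : Set (Eu d)) (Φ : PartialEquiv (Eu d) (Eu d)) (K : Coeff d) : Coeff d :=
  fun s y p =>
    |(jacobian Ω Φ (Φ.symm y)).det|⁻¹ •
      ((jacobian Ω Φ (Φ.symm y))ᵀ *
        K s (Φ.symm y) (WithLp.toLp 2 (jacobian Ω Φ (Φ.symm y) *ᵥ p.ofLp)) *
        jacobian Ω Φ (Φ.symm y))

end QuasilinearDN

end

/-!
The conductivity equation is the conservation law `div F = 0` for the flux `F = γ(u, x, ∇u) ∇u`, and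
the gauge transform is made so that the flux is a vector density: if `v = u ∘ Φ⁻¹`, the flux of `v`
for `H_Φ γ` is the push-forward `|det DΦ|⁻¹ DΦᵀ F` (`IsHolderDiffeo.flux_gaugeTransform`). Two facts
about push-forwards of densities give the theorem.

* The divergence of a push-forward is the push-forward of the divergence. With `Ψ = Φ⁻¹`, the
  push-forward is `± adj(DΨ)ᵀ (F ∘ Ψ)`, with a locally constant sign, and its divergence is computed
  by the Piola identity (`sum_fderiv_adjugate_eq_zero`): the columns of the cofactor matrix of a
  Jacobian matrix are divergence free. Only the differentiability of the flux is used, which is part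
  of the notion of solution. Hence `u ↦ u ∘ Φ⁻¹` maps solutions to solutions
  (`IsSolution.comp_symm`).
* The flux form through the boundary is unchanged (`conormalForm_gaugeTransform`). At a boundary
  point, `DΦ` is the identity on tangent vectors and maps inward vectors to inward vectors, so its
  determinant is positive, and this determinant is the factor by which it multiplies
  `F ⌟ dx¹ ∧ ⋯ ∧ dxⁿ` on tangent vectors (`volForm_fderivWithin_apply`).

The domain of the Dirichlet-to-Neumann map involves the topology of `C^{2,α}(Ω̄)`. Composition with
`Φ` and with `Φ⁻¹` is a bounded operator on this space
(`IsLipschitzDomain.exists_holderNorm_comp_le`), so a solution operator `S` with neighbourhood `U`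
yields the solution operator `f ↦ S f ∘ Φ⁻¹` with neighbourhood `{v | v ∘ Φ ∈ U}`
(`IsSolutionOperator.comp_symm`), on the same ball, since boundary values do not change. The Hölder
estimates proceed by induction on the order, from the product rule and the chain rule. They need
that functions with bounded derivative are Lipschitz on `Ω̄`, which need not be convex: near a
boundary point, two points of `Ω̄` are joined in `Ω̄` by a polygonal path of comparable length
(`IsDefiningFunction.exists_edist_le`).

The converse implications follow by applying this to `Φ⁻¹`, as `H_{Φ⁻¹} (H_Φ γ) = γ` on `Ω̄`.
-/

namespace QuasilinearDN

/-! ### Hölder norms, products and compositions -/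

section HolderCalculus

variable {E F G H : Type} [NormedAddCommGroup F] {s : Set E}

/-- The supremum of `‖u‖` over `s`, in `[0, ∞]`. -/
noncomputable def supENorm (s : Set E) (u : E → F) : ℝ≥0∞ := ⨆ x ∈ s, ‖u x‖ₑ

theorem enorm_le_supENorm (u : E → F) {x : E} (hx : x ∈ s) : ‖u x‖ₑ ≤ supENorm s u :=
  le_iSup₂ (f := fun x (_ : x ∈ s) => ‖u x‖ₑ) x hx

theorem supENorm_le {u : E → F} {C : ℝ≥0∞} (h : ∀ x ∈ s, ‖u x‖ₑ ≤ C) : supENorm s u ≤ C :=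
  iSup₂_le h

theorem supENorm_add_le (u v : E → F) : supENorm s (u + v) ≤ supENorm s u + supENorm s v :=
  supENorm_le fun _ hx => (enorm_add_le _ _).trans
    (add_le_add (enorm_le_supENorm u hx) (enorm_le_supENorm v hx))

variable [NormedAddCommGroup E] {α : ℝ≥0}

/-- The Hölder seminorm `[u]_{α; s}`, in `[0, ∞]`. -/
noncomputable def holderSeminorm (α : ℝ≥0) (s : Set E) (u : E → F) : ℝ≥0∞ := eHolderNorm α (s.domRestrict u)

theorem edist_le_holderSeminorm_mul (u : E → F) {x y : E} (hx : x ∈ s) (hy : y ∈ s) :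
    edist (u x) (u y) ≤ holderSeminorm α s u * edist x y ^ (α : ℝ) := by
  rcases eq_or_ne x y with rfl | hxy
  · simp
  by_cases h : _root_.MemHolder α (s.domRestrict u)
  · have := h.holderWith.edist_le ⟨x, hx⟩ ⟨y, hy⟩
    rwa [h.coe_nnHolderNorm_eq_eHolderNorm] at this
  · have h' : holderSeminorm α s u = ⊤ := eHolderNorm_eq_top.2 h
    have h0 : edist x y ^ (α : ℝ) ≠ 0 := by
      simp [ENNReal.rpow_eq_zero_iff, hxy, edist_ne_top]
    rw [h', ENNReal.top_mul h0]
    exact le_top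

theorem holderSeminorm_le {u : E → F} {C : ℝ≥0∞}
    (h : ∀ x ∈ s, ∀ y ∈ s, edist (u x) (u y) ≤ C * edist x y ^ (α : ℝ)) :
    holderSeminorm α s u ≤ C := by
  induction C using ENNReal.recTopCoe with
  | top => exact le_top
  | coe C => exact HolderWith.eHolderNorm_le fun x y => h x x.2 y y.2

/-- The Hölder seminorm only depends on the distances between the values. -/
theorem holderSeminorm_congr_edist {u : E → F} [NormedAddCommGroup G] {v : E → G}
    (h : ∀ x ∈ s, ∀ y ∈ s, edist (u x) (u y) = edist (v x) (v y)) :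
    holderSeminorm α s u = holderSeminorm α s v :=
  le_antisymm (holderSeminorm_le fun x hx y hy => h x hx y hy ▸ edist_le_holderSeminorm_mul v hx hy)
    (holderSeminorm_le fun x hx y hy => h x hx y hy ▸ edist_le_holderSeminorm_mul u hx hy)

variable [NormedSpace ℝ E] [NormedSpace ℝ F] [NormedAddCommGroup G] [NormedSpace ℝ G]
  [NormedAddCommGroup H] [NormedSpace ℝ H]

theorem holderNorm_zero (u : E → F) :
    holderNorm 0 α s u = supENorm s u + holderSeminorm α s u := by
  have h1 : eHolderNorm α (s.domRestrict (iteratedFDerivWithin ℝ 0 u s)) =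
      holderSeminorm α s u := by
    refine holderSeminorm_congr_edist fun x _ y _ => ?_
    rw [iteratedFDerivWithin_zero_eq_comp]
    exact LinearIsometryEquiv.edist_map _ _ _
  have h2 : ∀ x, ‖iteratedFDerivWithin ℝ 0 u s x‖ₑ = ‖u x‖ₑ := fun x => by
    rw [← ofReal_norm, ← ofReal_norm, norm_iteratedFDerivWithin_zero]
  rw [holderNorm, h1]
  simp [h2, supENorm]

/-- The Hölder norms can be computed by recursion on the order. -/
theorem holderNorm_succ (hs : UniqueDiffOn ℝ s) (k : ℕ) (u : E → F) :
    holderNorm (k + 1) α s u = supENorm s u + holderNorm k α s (fderivWithin ℝ u s) := by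
  have h1 : eHolderNorm α (s.domRestrict (iteratedFDerivWithin ℝ (k + 1) u s)) =
      eHolderNorm α (s.domRestrict (iteratedFDerivWithin ℝ k (fderivWithin ℝ u s) s)) := by
    refine holderSeminorm_congr_edist fun x hx y hy => ?_
    rw [iteratedFDerivWithin_succ_eq_comp_right hs hx, iteratedFDerivWithin_succ_eq_comp_right hs hy]
    exact LinearIsometryEquiv.edist_map _ _ _
  have h2 : ∀ x, ‖iteratedFDerivWithin ℝ 0 u s x‖ₑ = ‖u x‖ₑ := fun x => by
    rw [← ofReal_norm, ← ofReal_norm, norm_iteratedFDerivWithin_zero]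
  have h3 : ∀ j, ∀ x ∈ s, ‖iteratedFDerivWithin ℝ (j + 1) u s x‖ₑ =
      ‖iteratedFDerivWithin ℝ j (fderivWithin ℝ u s) s x‖ₑ := fun j x hx => by
    rw [← ofReal_norm, ← ofReal_norm, norm_iteratedFDerivWithin_fderivWithin hs hx]
  rw [holderNorm, holderNorm, h1, Finset.sum_range_succ', add_comm (Finset.sum _ _), add_assoc]
  congr 1
  · simp [h2, supENorm]
  · congr 1
    exact Finset.sum_congr rfl fun j _ => iSup_congr fun x => iSup_congr (h3 j x)

theorem holderNorm_congr {u v : E → F} (h : EqOn u v s) (k : ℕ) :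
    holderNorm k α s u = holderNorm k α s v := by
  have h1 : eHolderNorm α (s.domRestrict (iteratedFDerivWithin ℝ k u s)) =
      eHolderNorm α (s.domRestrict (iteratedFDerivWithin ℝ k v s)) := by
    refine holderSeminorm_congr_edist fun x hx y hy => ?_
    rw [iteratedFDerivWithin_congr h hx, iteratedFDerivWithin_congr h hy]
  rw [holderNorm, holderNorm, h1]
  congr 1
  refine Finset.sum_congr rfl fun j _ => iSup_congr fun x => iSup_congr fun hx => ?_
  rw [iteratedFDerivWithin_congr h hx]

theorem holderNorm_eq_zero_of_eqOn {u : E → F} (h : EqOn u 0 s) (k : ℕ) :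
    holderNorm k α s u = 0 := by
  have h0 : ∀ j, iteratedFDerivWithin ℝ j (0 : E → F) s = 0 := fun j =>
    iteratedFDerivWithin_fun_zero
  rw [holderNorm_congr h, holderNorm]
  simp only [h0]
  simp [show s.domRestrict (0 : E → E [×k]→L[ℝ] F) = 0 from rfl,
    show ∀ j, ‖(0 : E [×j]→L[ℝ] F)‖ₑ = 0 from fun j => by
      rw [← ofReal_norm, norm_zero, ENNReal.ofReal_zero]]

theorem supENorm_le_holderNorm (k : ℕ) (hs : UniqueDiffOn ℝ s) (u : E → F) :
    supENorm s u ≤ holderNorm k α s u := by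
  cases k with
  | zero => rw [holderNorm_zero]; exact le_self_add
  | succ k => rw [holderNorm_succ hs]; exact le_self_add

theorem MemHolder.congr {k : ℕ} {u v : E → F} (hu : MemHolder k α s u) (h : EqOn v u s) :
    MemHolder k α s v :=
  ⟨hu.1.congr h, (holderNorm_congr h k).trans_lt hu.2⟩

theorem holderNorm_add_le (hs : UniqueDiffOn ℝ s) (k : ℕ) :
    ∀ {F : Type} [NormedAddCommGroup F] [NormedSpace ℝ F] {u v : E → F},
      ContDiffOn ℝ k u s → ContDiffOn ℝ k v s →
      holderNorm k α s (u + v) ≤ holderNorm k α s u + holderNorm k α s v := by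
  induction k with
  | zero =>
    intro F _ _ u v _ _
    simp only [holderNorm_zero]
    calc supENorm s (u + v) + holderSeminorm α s (u + v)
        ≤ (supENorm s u + supENorm s v) + (holderSeminorm α s u + holderSeminorm α s v) := by
          refine add_le_add (supENorm_add_le u v) (holderSeminorm_le fun x hx y hy => ?_)
          rw [add_mul]
          exact (edist_add_add_le _ _ _ _).trans (add_le_add
            (edist_le_holderSeminorm_mul u hx hy) (edist_le_holderSeminorm_mul v hx hy))
      _ = _ := by ring
  | succ k ih =>
    intro F _ _ u v hu hv
    have h1 : EqOn (fderivWithin ℝ (u + v) s) (fderivWithin ℝ u s + fderivWithin ℝ v s) s :=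
      fun x hx => fderivWithin_add (hs x hx) (hu.differentiableOn (by simp) x hx)
        (hv.differentiableOn (by simp) x hx)
    rw [holderNorm_succ hs, holderNorm_succ hs, holderNorm_succ hs, holderNorm_congr h1]
    calc _ ≤ (supENorm s u + supENorm s v) +
          (holderNorm k α s (fderivWithin ℝ u s) + holderNorm k α s (fderivWithin ℝ v s)) :=
          add_le_add (supENorm_add_le u v) (ih (hu.fderivWithin hs (by norm_cast))
            (hv.fderivWithin hs (by norm_cast)))
      _ = _ := by ring

/-- A bounded set `s`, with unique derivatives, on which every differentiable function is
Lipschitz, with a constant controlled by the suprema of the function and of its derivative. This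
replaces the convexity of `s` in the estimates of the Hölder norms. -/
structure IsLipschitzDomain (s : Set E) : Prop where
  uniqueDiffOn : UniqueDiffOn ℝ s
  isBounded : Bornology.IsBounded s
  exists_edist_le : ∃ L : ℝ≥0, ∀ (F : Type) [NormedAddCommGroup F] [NormedSpace ℝ F] (g : E → F),
    DifferentiableOn ℝ g s → ∀ x ∈ s, ∀ y ∈ s,
      edist (g x) (g y) ≤ L * (supENorm s g + supENorm s (fderivWithin ℝ g s)) * edist x y

theorem IsLipschitzDomain.exists_holderSeminorm_le (hs : IsLipschitzDomain s) (hα : α ≤ 1) :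
    ∃ L : ℝ≥0, ∀ (F : Type) [NormedAddCommGroup F] [NormedSpace ℝ F] (g : E → F),
      DifferentiableOn ℝ g s →
        holderSeminorm α s g ≤ L * (supENorm s g + supENorm s (fderivWithin ℝ g s)) := by
  obtain ⟨L, hL⟩ := hs.exists_edist_le
  have hα' : 0 ≤ (1 - α : ℝ) := sub_nonneg.2 (by exact_mod_cast hα)
  have hd : Metric.ediam s ^ (1 - α : ℝ) ≠ ⊤ :=
    ENNReal.rpow_ne_top_of_nonneg hα' hs.isBounded.ediam_ne_top
  refine ⟨L * (Metric.ediam s ^ (1 - α : ℝ)).toNNReal, fun F _ _ g hg =>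
    holderSeminorm_le fun x hx y hy => (hL F g hg x hx y hy).trans ?_⟩
  have h1 : edist x y ≤ Metric.ediam s ^ (1 - α : ℝ) * edist x y ^ (α : ℝ) := by
    calc edist x y = edist x y ^ (1 - α : ℝ) * edist x y ^ (α : ℝ) := by
          rw [← ENNReal.rpow_add_of_nonneg _ _ hα' α.coe_nonneg]; simp
      _ ≤ _ := by
        gcongr
        exact Metric.edist_le_ediam_of_mem hx hy
  push_cast
  rw [ENNReal.coe_toNNReal hd]
  calc _ ≤ (L : ℝ≥0∞) * (supENorm s g + supENorm s (fderivWithin ℝ g s)) *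
        (Metric.ediam s ^ (1 - α : ℝ) * edist x y ^ (α : ℝ)) := by gcongr
    _ = _ := by ring

/-- The embedding of `C^{k+1,α}` into `C^{k,α}`. -/
theorem IsLipschitzDomain.exists_holderNorm_le_succ (hs : IsLipschitzDomain s) (hα : α ≤ 1)
    (k : ℕ) :
    ∃ C : ℝ≥0, ∀ (F : Type) [NormedAddCommGroup F] [NormedSpace ℝ F] (g : E → F),
      ContDiffOn ℝ (k + 1) g s → holderNorm k α s g ≤ C * holderNorm (k + 1) α s g := by
  induction k with
  | zero =>
    obtain ⟨L, hL⟩ := hs.exists_holderSeminorm_le hα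
    refine ⟨1 + L, fun F _ _ g hg => ?_⟩
    rw [holderNorm_succ hs.uniqueDiffOn, holderNorm_zero, holderNorm_zero]
    push_cast
    rw [add_mul, one_mul]
    refine add_le_add le_self_add ((hL F g (hg.differentiableOn (by simp))).trans ?_)
    gcongr
    exact le_self_add
  | succ k ih =>
    obtain ⟨C, hC⟩ := ih
    refine ⟨1 + C, fun F _ _ g hg => ?_⟩
    rw [holderNorm_succ hs.uniqueDiffOn, holderNorm_succ hs.uniqueDiffOn (k + 1)]
    push_cast
    rw [add_mul, one_mul]
    refine add_le_add le_self_add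
      ((hC _ (fderivWithin ℝ g s) (hg.fderivWithin hs.uniqueDiffOn (by norm_cast))).trans ?_)
    gcongr
    exact le_add_self

theorem enorm_bilin_le {B : F →L[ℝ] G →L[ℝ] H} (hB : ‖B‖ ≤ 1) (a : F) (b : G) :
    ‖B a b‖ₑ ≤ ‖a‖ₑ * ‖b‖ₑ := by
  simp only [← ofReal_norm]
  rw [← ENNReal.ofReal_mul (norm_nonneg _)]
  apply ENNReal.ofReal_le_ofReal
  have := B.le_opNorm₂ a b
  have h2 : ‖B‖ * ‖a‖ * ‖b‖ ≤ 1 * ‖a‖ * ‖b‖ := by gcongr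
  linarith

set_option maxSynthPendingDepth 3 in
/-- Hölder spaces are stable under products. -/
theorem IsLipschitzDomain.exists_holderNorm_bilin_le (hs : IsLipschitzDomain s) (hα : α ≤ 1)
    (k : ℕ) :
    ∃ C : ℝ≥0, ∀ (F G H : Type) [NormedAddCommGroup F] [NormedSpace ℝ F] [NormedAddCommGroup G]
      [NormedSpace ℝ G] [NormedAddCommGroup H] [NormedSpace ℝ H] (B : F →L[ℝ] G →L[ℝ] H)
      (f : E → F) (g : E → G), ‖B‖ ≤ 1 → ContDiffOn ℝ k f s → ContDiffOn ℝ k g s →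
      holderNorm k α s (fun x => B (f x) (g x)) ≤
        C * (holderNorm k α s f * holderNorm k α s g) := by
  have hsup : ∀ {F G H : Type} [NormedAddCommGroup F] [NormedSpace ℝ F] [NormedAddCommGroup G]
      [NormedSpace ℝ G] [NormedAddCommGroup H] [NormedSpace ℝ H] {B : F →L[ℝ] G →L[ℝ] H}
      (f : E → F) (g : E → G), ‖B‖ ≤ 1 →
      supENorm s (fun x => B (f x) (g x)) ≤ supENorm s f * supENorm s g :=
    fun f g hB => supENorm_le fun x hx => (enorm_bilin_le hB _ _).trans
      (mul_le_mul' (enorm_le_supENorm f hx) (enorm_le_supENorm g hx))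
  induction k with
  | zero =>
    refine ⟨1, fun F G H _ _ _ _ _ _ B f g hB _ _ => ?_⟩
    simp only [holderNorm_zero]
    have h1 : holderSeminorm α s (fun x => B (f x) (g x)) ≤
        supENorm s f * holderSeminorm α s g + holderSeminorm α s f * supENorm s g := by
      refine holderSeminorm_le fun x hx y hy => ?_
      have e : B (f x) (g x) - B (f y) (g y) = B (f x) (g x - g y) + B (f x - f y) (g y) := by
        simp
      rw [edist_eq_enorm_sub, e]
      refine (enorm_add_le _ _).trans ?_
      have h2 := edist_le_holderSeminorm_mul (α := α) f hx hy
      have h3 := edist_le_holderSeminorm_mul (α := α) g hx hy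
      rw [edist_eq_enorm_sub] at h2 h3
      calc _ ≤ ‖f x‖ₑ * ‖g x - g y‖ₑ + ‖f x - f y‖ₑ * ‖g y‖ₑ :=
            add_le_add (enorm_bilin_le hB _ _) (enorm_bilin_le hB _ _)
        _ ≤ supENorm s f * (holderSeminorm α s g * edist x y ^ (α : ℝ)) +
            (holderSeminorm α s f * edist x y ^ (α : ℝ)) * supENorm s g := by
          gcongr
          · exact enorm_le_supENorm f hx
          · exact enorm_le_supENorm g hy
        _ = _ := by ring
    calc _ ≤ supENorm s f * supENorm s g +
          (supENorm s f * holderSeminorm α s g + holderSeminorm α s f * supENorm s g) :=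
          add_le_add (hsup f g hB) h1
      _ ≤ supENorm s f * supENorm s g +
          (supENorm s f * holderSeminorm α s g + holderSeminorm α s f * supENorm s g) +
          holderSeminorm α s f * holderSeminorm α s g := le_self_add
      _ = _ := by push_cast; ring
  | succ k ih =>
    obtain ⟨C, hC⟩ := ih
    obtain ⟨C', hC'⟩ := hs.exists_holderNorm_le_succ hα k
    refine ⟨1 + C * C' + C * C', fun F G H _ _ _ _ _ _ B f g hB hf hg => ?_⟩
    have hs' := hs.uniqueDiffOn
    have hle : (k : WithTop ℕ∞) ≤ ((k + 1 : ℕ) : WithTop ℕ∞) := by norm_cast; omega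
    have hle' : (k : WithTop ℕ∞) + 1 ≤ ((k + 1 : ℕ) : WithTop ℕ∞) := by norm_cast
    have hf' : ContDiffOn ℝ k (fderivWithin ℝ f s) s := hf.fderivWithin hs' hle'
    have hg' : ContDiffOn ℝ k (fderivWithin ℝ g s) s := hg.fderivWithin hs' hle'
    have e : EqOn (fderivWithin ℝ (fun x => B (f x) (g x)) s)
        ((fun x => B.precompR E (f x) (fderivWithin ℝ g s x)) +
          fun x => B.precompL E (fderivWithin ℝ f s x) (g x)) s := fun x hx =>
      B.fderivWithin_of_bilinear (hf.differentiableOn (by simp) x hx)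
        (hg.differentiableOn (by simp) x hx) (hs' x hx)
    have hR : ‖B.precompR E‖ ≤ 1 := (B.norm_precompR_le E).trans hB
    have hL : ‖B.precompL E‖ ≤ 1 := (B.norm_precompL_le E).trans hB
    have c1 : ContDiffOn ℝ k (fun x => B.precompR E (f x) (fderivWithin ℝ g s x)) s :=
      (B.precompR E).isBoundedBilinearMap.contDiff.comp₂_contDiffOn (hf.of_le hle) hg'
    have c2 : ContDiffOn ℝ k (fun x => B.precompL E (fderivWithin ℝ f s x) (g x)) s :=
      (B.precompL E).isBoundedBilinearMap.contDiff.comp₂_contDiffOn hf' (hg.of_le hle)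
    have b1 := hC _ _ _ (B.precompR E) f (fderivWithin ℝ g s) hR (hf.of_le hle) hg'
    have b2 := hC _ _ _ (B.precompL E) (fderivWithin ℝ f s) g hL hf' (hg.of_le hle)
    have i1 := hC' _ f (hf.of_le (by norm_cast))
    have i2 := hC' _ g (hg.of_le (by norm_cast))
    have j1 : holderNorm k α s (fderivWithin ℝ f s) ≤ holderNorm (k + 1) α s f := by
      rw [holderNorm_succ hs']; exact le_add_self
    have j2 : holderNorm k α s (fderivWithin ℝ g s) ≤ holderNorm (k + 1) α s g := by
      rw [holderNorm_succ hs']; exact le_add_self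
    have l1 := supENorm_le_holderNorm (α := α) (k + 1) hs' f
    have l2 := supENorm_le_holderNorm (α := α) (k + 1) hs' g
    rw [holderNorm_succ hs', holderNorm_congr e]
    calc _ ≤ supENorm s f * supENorm s g +
          (C * (holderNorm k α s f * holderNorm k α s (fderivWithin ℝ g s)) +
            C * (holderNorm k α s (fderivWithin ℝ f s) * holderNorm k α s g)) :=
          add_le_add (hsup f g hB) ((holderNorm_add_le hs' k c1 c2).trans (add_le_add b1 b2))
      _ ≤ holderNorm (k + 1) α s f * holderNorm (k + 1) α s g +
          (C * ((C' * holderNorm (k + 1) α s f) * holderNorm (k + 1) α s g) +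
            C * (holderNorm (k + 1) α s f * (C' * holderNorm (k + 1) α s g))) := by
          gcongr
      _ = _ := by push_cast; ring

/-- Composition with a fixed map `Φ` of class `C^{k+1,α}` is bounded on `C^{k,α}`. -/
theorem IsLipschitzDomain.exists_holderNorm_comp_le (hs : IsLipschitzDomain s) (hα : α ≤ 1)
    {Φ : E → E} (hΦs : MapsTo Φ s s) (k : ℕ) (hΦ : MemHolder (k + 1) α s Φ) :
    ∃ C : ℝ≥0, ∀ (F : Type) [NormedAddCommGroup F] [NormedSpace ℝ F] (g : E → F),
      ContDiffOn ℝ k g s → holderNorm k α s (g ∘ Φ) ≤ C * holderNorm k α s g := by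
  have hs' := hs.uniqueDiffOn
  have hsup : ∀ {F : Type} [NormedAddCommGroup F] (g : E → F),
      supENorm s (g ∘ Φ) ≤ supENorm s g :=
    fun g => supENorm_le fun x hx => enorm_le_supENorm g (hΦs hx)
  induction k with
  | zero =>
    obtain ⟨L, hL⟩ := hs.exists_edist_le
    have hfin : (L : ℝ≥0∞) * (supENorm s Φ + supENorm s (fderivWithin ℝ Φ s)) ≠ ⊤ := by
      have h := hΦ.2
      rw [holderNorm_succ hs', holderNorm_zero, ← add_assoc] at h
      exact ENNReal.mul_ne_top ENNReal.coe_ne_top (le_self_add.trans_lt h).ne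
    have hLip := hL E Φ (hΦ.1.differentiableOn (by simp))
    set M := (L : ℝ≥0∞) * (supENorm s Φ + supENorm s (fderivWithin ℝ Φ s))
    have hM : M ^ (α : ℝ) ≠ ⊤ := ENNReal.rpow_ne_top_of_nonneg α.coe_nonneg hfin
    refine ⟨1 + (M ^ (α : ℝ)).toNNReal, fun F _ _ g _ => ?_⟩
    simp only [holderNorm_zero]
    have h1 : holderSeminorm α s (g ∘ Φ) ≤ M ^ (α : ℝ) * holderSeminorm α s g := by
      refine holderSeminorm_le fun x hx y hy => ?_
      calc _ ≤ holderSeminorm α s g * edist (Φ x) (Φ y) ^ (α : ℝ) :=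
            edist_le_holderSeminorm_mul g (hΦs hx) (hΦs hy)
        _ ≤ holderSeminorm α s g * (M * edist x y) ^ (α : ℝ) := by
            gcongr
            exact hLip x hx y hy
        _ = _ := by rw [ENNReal.mul_rpow_of_nonneg _ _ α.coe_nonneg]; ring
    push_cast
    rw [ENNReal.coe_toNNReal hM, add_mul, one_mul]
    refine add_le_add ((hsup g).trans le_self_add) (h1.trans ?_)
    gcongr
    exact le_add_self
  | succ k ih =>
    have hΦ' := hΦ.2
    rw [holderNorm_succ hs'] at hΦ'
    have hDΦ : holderNorm (k + 1) α s (fderivWithin ℝ Φ s) ≠ ⊤ :=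
      (le_add_self.trans_lt hΦ').ne
    obtain ⟨C₁, hC₁⟩ := hs.exists_holderNorm_le_succ hα k
    obtain ⟨C₂, hC₂⟩ := hs.exists_holderNorm_le_succ hα (k + 1)
    obtain ⟨C₃, hC₃⟩ := hs.exists_holderNorm_bilin_le hα k
    have hle : ((k + 1 : ℕ) : WithTop ℕ∞) ≤ ((k + 1 + 1 : ℕ) : WithTop ℕ∞) := by
      norm_cast; omega
    have hcD : ContDiffOn ℝ (k + 1 : ℕ) (fderivWithin ℝ Φ s) s :=
      hΦ.1.fderivWithin hs' (by norm_cast)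
    have hDk : holderNorm k α s (fderivWithin ℝ Φ s) ≠ ⊤ :=
      ((hC₁ _ _ (by exact_mod_cast hcD)).trans_lt
        (ENNReal.mul_lt_top ENNReal.coe_lt_top hDΦ.lt_top)).ne
    obtain ⟨C, hC⟩ := ih ⟨hΦ.1.of_le hle, (hC₂ _ Φ (by exact_mod_cast hΦ.1)).trans_lt
      (ENNReal.mul_lt_top ENNReal.coe_lt_top hΦ.2)⟩
    refine ⟨1 + C₃ * (C * (holderNorm k α s (fderivWithin ℝ Φ s)).toNNReal),
      fun F _ _ g hg => ?_⟩
    have hg' : ContDiffOn ℝ k (fderivWithin ℝ g s) s := hg.fderivWithin hs' (by norm_cast)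
    have e : EqOn (fderivWithin ℝ (g ∘ Φ) s)
        (fun x => ContinuousLinearMap.compL ℝ E E F ((fderivWithin ℝ g s ∘ Φ) x)
          (fderivWithin ℝ Φ s x)) s := fun x hx =>
      fderivWithin_comp x (hg.differentiableOn (by simp) _ (hΦs hx))
        (hΦ.1.differentiableOn (by simp) x hx) hΦs (hs' x hx)
    have hk : (k : WithTop ℕ∞) ≤ ((k + 1 : ℕ) : WithTop ℕ∞) := by norm_cast; omega
    have b := hC₃ _ _ _ (ContinuousLinearMap.compL ℝ E E F) (fderivWithin ℝ g s ∘ Φ)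
      (fderivWithin ℝ Φ s) (ContinuousLinearMap.norm_compL_le ℝ E E F)
      (hg'.comp (hΦ.1.of_le (hk.trans hle)) hΦs) (hcD.of_le hk)
    rw [holderNorm_succ hs', holderNorm_succ hs', holderNorm_congr e]
    push_cast
    rw [ENNReal.coe_toNNReal hDk, add_mul, one_mul]
    refine add_le_add ((hsup g).trans le_self_add) (b.trans ?_)
    calc _ ≤ (C₃ : ℝ≥0∞) * ((C * holderNorm k α s (fderivWithin ℝ g s)) *
          holderNorm k α s (fderivWithin ℝ Φ s)) := by
          gcongr
          exact hC _ _ hg'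
      _ = C₃ * (C * holderNorm k α s (fderivWithin ℝ Φ s)) *
          holderNorm k α s (fderivWithin ℝ g s) := by ring
      _ ≤ _ := by
          gcongr
          exact le_add_self

theorem IsLipschitzDomain.memHolder_comp (hs : IsLipschitzDomain s) (hα : α ≤ 1)
    {Φ : E → E} (hΦs : MapsTo Φ s s) {k : ℕ} (hΦ : MemHolder (k + 1) α s Φ) {g : E → F}
    (hg : MemHolder k α s g) : MemHolder k α s (g ∘ Φ) := by
  obtain ⟨C, hC⟩ := hs.exists_holderNorm_comp_le hα hΦs k hΦ
  exact ⟨hg.1.comp (hΦ.1.of_le (by norm_cast; omega)) hΦs, (hC F g hg.1).trans_lt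
    (ENNReal.mul_lt_top ENNReal.coe_lt_top hg.2)⟩

end HolderCalculus

/-! ### Geometry of smooth bounded domains -/

section BoundaryGeometry

open Filter Topology

/-- The mean value inequality along a segment contained in `s`. -/
theorem edist_le_of_segment_subset {E F : Type} [NormedAddCommGroup E] [NormedSpace ℝ E]
    [NormedAddCommGroup F] [NormedSpace ℝ F] {s : Set E} {g : E → F} (hg : DifferentiableOn ℝ g s)
    {x y : E} (h : segment ℝ x y ⊆ s) :
    edist (g x) (g y) ≤ supENorm s (fderivWithin ℝ g s) * edist x y := by
  rcases eq_or_ne x y with rfl | hxy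
  · simp
  by_cases hM : supENorm s (fderivWithin ℝ g s) = ⊤
  · rw [hM, ENNReal.top_mul (by simpa using hxy)]
    exact le_top
  · have h1 : ∀ z ∈ segment ℝ x y, ‖fderivWithin ℝ g s z‖₊ ≤
        (supENorm s (fderivWithin ℝ g s)).toNNReal := fun z hz => by
      rw [← ENNReal.coe_le_coe, ENNReal.coe_toNNReal hM]
      exact enorm_le_supENorm (fderivWithin ℝ g s) (h hz)
    have h2 := (convex_segment x y).lipschitzOnWith_of_nnnorm_hasFDerivWithin_le
      (fun z hz => (hg z (h hz)).hasFDerivWithinAt.mono h) h1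
    have h3 := h2 (left_mem_segment ℝ x y) (right_mem_segment ℝ x y)
    rwa [ENNReal.coe_toNNReal hM] at h3

variable {d : ℕ} {Ω : Set (Eu d)} {x₀ : Eu d} {ρ : Eu d → ℝ}

/-- `ρ` is a smooth defining function of the open set `Ω` near its boundary point `x₀`. -/
structure IsDefiningFunction (Ω : Set (Eu d)) (x₀ : Eu d) (ρ : Eu d → ℝ) : Prop where
  isOpen : IsOpen Ω
  mem_frontier : x₀ ∈ frontier Ω
  contDiff : ContDiff ℝ ∞ ρ
  fderiv_ne_zero : fderiv ℝ ρ x₀ ≠ 0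
  eventually : ∀ᶠ x in 𝓝 x₀, x ∈ Ω ↔ ρ x < 0

theorem IsSmoothBoundedDomain.exists_isDefiningFunction (hΩ : IsSmoothBoundedDomain Ω)
    (hx₀ : x₀ ∈ frontier Ω) : ∃ ρ, IsDefiningFunction Ω x₀ ρ := by
  obtain ⟨V, hV, ρ, h1, h2, h3⟩ := hΩ.smoothBoundary x₀ hx₀
  exact ⟨ρ, hΩ.isOpen, hx₀, h1, h2, mem_of_superset hV h3⟩

namespace IsDefiningFunction

theorem exists_inward (h : IsDefiningFunction Ω x₀ ρ) : ∃ e, fderiv ℝ ρ x₀ e = -1 := by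
  obtain ⟨v, hv⟩ := DFunLike.ne_iff.1 h.fderiv_ne_zero
  rw [zero_apply] at hv
  exact ⟨-(fderiv ℝ ρ x₀ v)⁻¹ • v, by simp [hv]⟩

/-- Along an inward direction `e`, the defining function decreases at a definite rate, uniformly
near the boundary point. -/
theorem exists_ball (h : IsDefiningFunction Ω x₀ ρ) {e : Eu d} (he : fderiv ℝ ρ x₀ e = -1) :
    ∃ K r : ℝ, 0 < r ∧ 0 ≤ K ∧
      (∀ x ∈ Metric.ball x₀ r, x ∈ Ω ↔ ρ x < 0) ∧
      (∀ x ∈ Metric.ball x₀ r, ∀ y ∈ Metric.ball x₀ r, |ρ y - ρ x| ≤ K * ‖y - x‖) ∧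
      (∀ x ∈ Metric.ball x₀ r, ∀ t : ℝ, 0 ≤ t → x + t • e ∈ Metric.ball x₀ r →
        ρ (x + t • e) ≤ ρ x - t / 2) := by
  have hc : Continuous (fderiv ℝ ρ) := h.contDiff.continuous_fderiv (by simp)
  have hd : Differentiable ℝ ρ := h.contDiff.differentiable (by simp)
  have h1 : ∀ᶠ x in 𝓝 x₀, fderiv ℝ ρ x e < -(1 / 2) :=
    (hc.clm_apply continuous_const).continuousAt.eventually_lt continuousAt_const
      (by rw [he]; norm_num)
  have h2 : ∀ᶠ x in 𝓝 x₀, ‖fderiv ℝ ρ x‖ < ‖fderiv ℝ ρ x₀‖ + 1 :=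
    hc.norm.continuousAt.eventually_lt continuousAt_const (by simp)
  obtain ⟨r, hr, hball⟩ := Metric.eventually_nhds_iff_ball.1 (h.eventually.and (h1.and h2))
  refine ⟨‖fderiv ℝ ρ x₀‖ + 1, r, hr, by positivity, fun x hx => (hball x hx).1,
    fun x hx y hy => ?_, fun x hx t ht hxt => ?_⟩
  · exact (convex_ball x₀ r).norm_image_sub_le_of_norm_fderiv_le (𝕜 := ℝ)
      (fun z _ => hd z) (fun z hz => (hball z hz).2.2.le) hx hy
  · have hder : ∀ τ : ℝ, HasDerivAt (fun τ : ℝ => ρ (x + τ • e)) (fderiv ℝ ρ (x + τ • e) e) τ :=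
      fun τ => by
        have := ((hasDerivAt_id τ).smul_const e).const_add x
        rw [one_smul] at this
        exact (hd _).hasFDerivAt.comp_hasDerivAt τ this
    have hmem : ∀ τ ∈ Icc 0 t, x + τ • e ∈ Metric.ball x₀ r := fun τ hτ => by
      rcases eq_or_lt_of_le ht with rfl | ht0
      · obtain rfl : τ = 0 := le_antisymm hτ.2 hτ.1
        simpa using hx
      · have := (convex_ball x₀ r).add_smul_sub_mem hx hxt
          (t := τ / t) ⟨div_nonneg hτ.1 ht, div_le_one_of_le₀ hτ.2 ht⟩
        rwa [add_sub_cancel_left, smul_smul, div_mul_cancel₀ _ ht0.ne'] at this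
    have h3 := (convex_Icc 0 t).image_sub_le_mul_sub_of_deriv_le (f := fun τ : ℝ => ρ (x + τ • e))
      (C := -(1 / 2)) (fun τ _ => (hder τ).continuousAt.continuousWithinAt)
      (fun τ _ => (hder τ).differentiableAt.differentiableWithinAt)
      (fun τ hτ => by
        rw [(hder τ).deriv]
        exact (hball _ (hmem τ (interior_subset hτ))).2.1.le)
      0 (left_mem_Icc.2 ht) t (right_mem_Icc.2 ht) ht
    simp only [zero_smul, add_zero] at h3
    linarith

theorem exists_ball_mem_closure_iff (h : IsDefiningFunction Ω x₀ ρ) :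
    ∃ r > 0, ∀ x ∈ Metric.ball x₀ r, x ∈ closure Ω ↔ ρ x ≤ 0 := by
  obtain ⟨e, he⟩ := h.exists_inward
  obtain ⟨K, r, hr, -, hΩ, -, hdec⟩ := h.exists_ball he
  refine ⟨r, hr, fun x hx => ⟨fun hxc => ?_, fun hx0 => ?_⟩⟩
  · by_contra! hpos
    have h1 : ∀ᶠ y in 𝓝 x, 0 < ρ y :=
      continuousAt_const.eventually_lt h.contDiff.continuous.continuousAt hpos
    obtain ⟨y, hy, hyr, hyΩ⟩ := ((mem_closure_iff_frequently.1 hxc).and_eventually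
      (h1.and (Metric.isOpen_ball.mem_nhds hx))).exists
    exact absurd ((hΩ y hyΩ).1 hy) (not_lt.2 hyr.le)
  · have hcont : Tendsto (fun t : ℝ => x + t • e) (𝓝[>] 0) (𝓝 x) := by
      have : Continuous fun t : ℝ => x + t • e := by fun_prop
      simpa using (this.tendsto 0).mono_left nhdsWithin_le_nhds
    refine mem_closure_of_tendsto hcont ?_
    filter_upwards [hcont (Metric.isOpen_ball.mem_nhds hx), self_mem_nhdsWithin] with t ht ht0
    rw [hΩ _ ht]
    have := hdec x hx t (le_of_lt ht0) ht
    have : (0 : ℝ) < t := ht0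
    linarith

theorem apply_eq_zero (h : IsDefiningFunction Ω x₀ ρ) : ρ x₀ = 0 := by
  obtain ⟨r, hr, hcl⟩ := h.exists_ball_mem_closure_iff
  have h1 := h.mem_frontier
  rw [h.isOpen.frontier_eq] at h1
  exact le_antisymm ((hcl x₀ (Metric.mem_ball_self hr)).1 h1.1)
    (not_lt.1 fun h2 => h1.2 (h.eventually.self_of_nhds.2 h2))

theorem mem_posTangentConeAt (h : IsDefiningFunction Ω x₀ ρ) {e : Eu d}
    (he : fderiv ℝ ρ x₀ e = -1) : e ∈ tangentConeAt ℝ≥0 (closure Ω) x₀ := by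
  obtain ⟨K, r, hr, -, hΩ, -, hdec⟩ := h.exists_ball he
  refine mem_tangentConeAt_of_add_smul_mem (tendsto_id'.mpr <| nhdsGT_le_nhdsNE 0) ?_
  have hcont : Tendsto (fun t : ℝ≥0 => x₀ + t • e) (𝓝[>] 0) (𝓝 x₀) := by
    have : Continuous fun t : ℝ≥0 => x₀ + t • e := by fun_prop
    simpa using (this.tendsto 0).mono_left nhdsWithin_le_nhds
  filter_upwards [hcont (Metric.ball_mem_nhds x₀ hr), self_mem_nhdsWithin] with t ht ht0
  refine subset_closure ((hΩ _ ht).2 ?_)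
  have h1 := hdec x₀ (Metric.mem_ball_self hr) t t.2 ht
  have h2 : (0 : ℝ) < t := ht0
  rw [h.apply_eq_zero] at h1
  exact h1.trans_lt (by linarith)

theorem uniqueDiffWithinAt (h : IsDefiningFunction Ω x₀ ρ) :
    UniqueDiffWithinAt ℝ (closure Ω) x₀ := by
  refine ⟨?_, subset_closure h.mem_frontier.1⟩
  obtain ⟨e, he⟩ := h.exists_inward
  have hmem : ∀ v, fderiv ℝ ρ x₀ v = -1 →
      v ∈ Submodule.span ℝ (tangentConeAt ℝ (closure Ω) x₀) := fun v hv =>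
    Submodule.subset_span (tangentConeAt_mono_field (h.mem_posTangentConeAt hv))
  have htop : Submodule.span ℝ (tangentConeAt ℝ (closure Ω) x₀) = ⊤ := by
    refine (Submodule.eq_top_iff').2 fun w => ?_
    have e1 : w = (e + (w + fderiv ℝ ρ x₀ w • e)) - (1 + fderiv ℝ ρ x₀ w) • e := by module
    rw [e1]
    exact Submodule.sub_mem _ (hmem _ (by simp [he])) (Submodule.smul_mem _ _ (hmem e he))
  rw [htop]
  simp

/-- Near a boundary point, any two points of `closure Ω` are joined in `closure Ω` by a path made
of three segments, whose length is comparable to the distance of the points: one follows the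
inward direction, then a parallel to the chord, and then comes back. -/
theorem exists_edist_le (h : IsDefiningFunction Ω x₀ ρ) :
    ∃ L : ℝ≥0, ∃ r > 0, ∀ (F : Type) [NormedAddCommGroup F] [NormedSpace ℝ F] (g : Eu d → F),
      DifferentiableOn ℝ g (closure Ω) →
      ∀ x ∈ closure Ω ∩ Metric.ball x₀ r, ∀ y ∈ closure Ω ∩ Metric.ball x₀ r,
        edist (g x) (g y) ≤
          L * supENorm (closure Ω) (fderivWithin ℝ g (closure Ω)) * edist x y := by
  obtain ⟨e, he⟩ := h.exists_inward
  obtain ⟨K, r₁, hr₁, hK, -, hLip, hdec⟩ := h.exists_ball he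
  obtain ⟨r₂, hr₂, hcl⟩ := h.exists_ball_mem_closure_iff
  set r₀ := min r₁ r₂
  have hr₀ : 0 < r₀ := lt_min hr₁ hr₂
  have hb₁ : ∀ {z}, z ∈ Metric.ball x₀ r₀ → z ∈ Metric.ball x₀ r₁ := fun hz =>
    Metric.ball_subset_ball (min_le_left _ _) hz
  have hb₂ : ∀ {z}, z ∈ Metric.ball x₀ r₀ → z ∈ Metric.ball x₀ r₂ := fun hz =>
    Metric.ball_subset_ball (min_le_right _ _) hz
  have hD : 0 < 1 + 4 * K * ‖e‖ := by positivity
  refine ⟨Real.toNNReal (4 * K * ‖e‖ + 1), r₀ / (1 + 4 * K * ‖e‖), by positivity,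
    fun F _ _ g hg x hx y hy => ?_⟩
  have hsmall : r₀ / (1 + 4 * K * ‖e‖) * (1 + 4 * K * ‖e‖) = r₀ := div_mul_cancel₀ _ hD.ne'
  set r := r₀ / (1 + 4 * K * ‖e‖)
  have hxr := Metric.mem_ball.1 hx.2
  have hyr := Metric.mem_ball.1 hy.2
  have hr : 0 < r := by positivity
  have hxy : ‖x - y‖ ≤ 2 * r := by
    rw [← dist_eq_norm]
    linarith [dist_triangle_right x y x₀]
  set t := 2 * K * ‖x - y‖
  have ht : 0 ≤ t := by positivity
  have hte : t * ‖e‖ ≤ r * (4 * K * ‖e‖) := by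
    have htr : t ≤ 2 * K * (2 * r) := mul_le_mul_of_nonneg_left hxy (by positivity)
    calc t * ‖e‖ ≤ 2 * K * (2 * r) * ‖e‖ := by gcongr
      _ = _ := by ring
  have hball : ∀ z, dist z x₀ < r → z ∈ Metric.ball x₀ r₀ ∧ z + t • e ∈ Metric.ball x₀ r₀ := by
    intro z hz
    have h0 : 0 ≤ r * (4 * K * ‖e‖) := by positivity
    refine ⟨Metric.mem_ball.2 (by linarith), Metric.mem_ball.2 ?_⟩
    calc dist (z + t • e) x₀ ≤ dist (z + t • e) z + dist z x₀ := dist_triangle _ _ _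
      _ = t * ‖e‖ + dist z x₀ := by
        rw [dist_eq_norm, add_sub_cancel_left, norm_smul, Real.norm_of_nonneg ht]
      _ < r₀ := by linarith
  have hseg : ∀ z ∈ closure Ω, dist z x₀ < r → segment ℝ z (z + t • e) ⊆ closure Ω := by
    intro z hzΩ hz w hw
    have hwb := (convex_ball x₀ r₀).segment_subset (hball z hz).1 (hball z hz).2 hw
    rw [segment_eq_image'] at hw
    obtain ⟨θ, hθ, rfl⟩ := hw
    simp only [add_sub_cancel_left, smul_smul] at hwb ⊢
    rw [hcl _ (hb₂ hwb)]
    have h1 := hdec z (hb₁ (hball z hz).1) (θ * t) (mul_nonneg hθ.1 ht) (hb₁ hwb)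
    have h2 := (hcl z (hb₂ (hball z hz).1)).1 hzΩ
    have h3 := mul_nonneg hθ.1 ht
    linarith
  have hmid : segment ℝ (x + t • e) (y + t • e) ⊆ closure Ω := by
    intro w hw
    have hwb := (convex_ball x₀ r₀).segment_subset (hball x hxr).2 (hball y hyr).2 hw
    have hwn : ‖w - (x + t • e)‖ ≤ ‖x - y‖ := by
      rw [segment_eq_image'] at hw
      obtain ⟨θ, hθ, rfl⟩ := hw
      rw [add_sub_cancel_left, add_sub_add_right_eq_sub, norm_smul, Real.norm_of_nonneg hθ.1,
        norm_sub_rev y x]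
      exact mul_le_of_le_one_left (norm_nonneg _) hθ.2
    rw [hcl _ (hb₂ hwb)]
    have h1 := hdec x (hb₁ (hball x hxr).1) t ht (hb₁ (hball x hxr).2)
    have h2 := (hcl x (hb₂ (hball x hxr).1)).1 hx.1
    have h3 := (le_abs_self _).trans (hLip _ (hb₁ (hball x hxr).2) _ (hb₁ hwb))
    have h4 : K * ‖w - (x + t • e)‖ ≤ K * ‖x - y‖ := by gcongr
    have h5 : t / 2 = K * ‖x - y‖ := by simp only [t]; ring
    linarith
  set M := supENorm (closure Ω) (fderivWithin ℝ g (closure Ω))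
  have i1 := edist_le_of_segment_subset hg (hseg x hx.1 hxr)
  have i2 := edist_le_of_segment_subset hg hmid
  have i3 := edist_le_of_segment_subset hg (hseg y hy.1 hyr)
  have e1 : ∀ z : Eu d, edist z (z + t • e) = ENNReal.ofReal (2 * K * ‖e‖) * edist x y := by
    intro z
    rw [edist_dist, edist_dist, ← ENNReal.ofReal_mul (by positivity), dist_eq_norm, dist_eq_norm,
      sub_add_cancel_left, norm_neg, norm_smul, Real.norm_of_nonneg ht]
    congr 1
    simp only [t]; ring
  have e2 : edist (x + t • e) (y + t • e) = edist x y := by simp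
  rw [e1] at i1 i3
  rw [e2] at i2
  rw [edist_comm] at i3
  have e3 : ((Real.toNNReal (4 * K * ‖e‖ + 1) : ℝ≥0) : ℝ≥0∞) =
      ENNReal.ofReal (2 * K * ‖e‖) + 1 + ENNReal.ofReal (2 * K * ‖e‖) := by
    rw [← ENNReal.ofReal_one, ← ENNReal.ofReal_add (by positivity) (by norm_num),
      ← ENNReal.ofReal_add (by positivity) (by positivity)]
    congr 2
    ring
  rw [e3]
  calc edist (g x) (g y) ≤ edist (g x) (g (x + t • e)) + edist (g (x + t • e)) (g (y + t • e)) +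
        edist (g (y + t • e)) (g y) := edist_triangle4 _ _ _ _
    _ ≤ M * (ENNReal.ofReal (2 * K * ‖e‖) * edist x y) + M * edist x y +
        M * (ENNReal.ofReal (2 * K * ‖e‖) * edist x y) := add_le_add (add_le_add i1 i2) i3
    _ = _ := by ring

end IsDefiningFunction

/-- The closure of a bounded domain with smooth boundary is a Lipschitz domain. -/
theorem IsSmoothBoundedDomain.isLipschitzDomain (hΩ : IsSmoothBoundedDomain Ω) :
    IsLipschitzDomain (closure Ω) := by
  refine ⟨fun x hx => ?_, hΩ.isBounded.closure, ?_⟩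
  · by_cases hxΩ : x ∈ Ω
    · exact uniqueDiffWithinAt_of_mem_nhds (mem_of_superset (hΩ.isOpen.mem_nhds hxΩ) subset_closure)
    · obtain ⟨ρ, hρ⟩ := hΩ.exists_isDefiningFunction
        (hΩ.isOpen.frontier_eq ▸ ⟨hx, hxΩ⟩ : x ∈ frontier Ω)
      exact hρ.uniqueDiffWithinAt
  · have hcomp : IsCompact (closure Ω) :=
      Metric.isCompact_of_isClosed_isBounded isClosed_closure hΩ.isBounded.closure
    -- By compactness, the local estimates give one for pairs of points at distance less than `δ`.
    obtain ⟨L, δ, hδ, hL⟩ : ∃ L : ℝ≥0, ∃ δ > 0, ∀ (F : Type) [NormedAddCommGroup F]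
        [NormedSpace ℝ F] (g : Eu d → F), DifferentiableOn ℝ g (closure Ω) →
        ∀ x ∈ closure Ω, ∀ y ∈ closure Ω, dist x y < δ → edist (g x) (g y) ≤
          L * supENorm (closure Ω) (fderivWithin ℝ g (closure Ω)) * edist x y := by
      refine hcomp.induction_on (p := fun A => ∃ L : ℝ≥0, ∃ δ > 0, ∀ (F : Type)
        [NormedAddCommGroup F] [NormedSpace ℝ F] (g : Eu d → F), DifferentiableOn ℝ g (closure Ω) →
        ∀ x ∈ A, ∀ y ∈ closure Ω, dist x y < δ → edist (g x) (g y) ≤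
          L * supENorm (closure Ω) (fderivWithin ℝ g (closure Ω)) * edist x y) ?_ ?_ ?_ ?_
      · exact ⟨0, 1, one_pos, fun F _ _ g _ x hx => absurd hx (notMem_empty x)⟩
      · rintro A B hAB ⟨L, δ, hδ, h⟩
        exact ⟨L, δ, hδ, fun F _ _ g hg x hx => h F g hg x (hAB hx)⟩
      · rintro A B ⟨L, δ, hδ, h⟩ ⟨L', δ', hδ', h'⟩
        refine ⟨max L L', min δ δ', lt_min hδ hδ', fun F _ _ g hg x hx y hy hxy => ?_⟩
        rcases hx with hx | hx
        · refine (h F g hg x hx y hy (hxy.trans_le (min_le_left _ _))).trans ?_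
          gcongr
          exact le_max_left _ _
        · refine (h' F g hg x hx y hy (hxy.trans_le (min_le_right _ _))).trans ?_
          gcongr
          exact le_max_right _ _
      · intro x₀ hx₀
        obtain ⟨L, r, hr, h⟩ : ∃ L : ℝ≥0, ∃ r > 0, ∀ (F : Type) [NormedAddCommGroup F]
            [NormedSpace ℝ F] (g : Eu d → F), DifferentiableOn ℝ g (closure Ω) →
            ∀ x ∈ closure Ω ∩ Metric.ball x₀ r, ∀ y ∈ closure Ω ∩ Metric.ball x₀ r,
              edist (g x) (g y) ≤
                L * supENorm (closure Ω) (fderivWithin ℝ g (closure Ω)) * edist x y := by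
          by_cases hxΩ : x₀ ∈ Ω
          · obtain ⟨r, hr, hball⟩ := Metric.isOpen_iff.1 hΩ.isOpen x₀ hxΩ
            refine ⟨1, r, hr, fun F _ _ g hg x hx y hy => ?_⟩
            rw [ENNReal.coe_one, one_mul]
            exact edist_le_of_segment_subset hg
              (((convex_ball x₀ r).segment_subset hx.2 hy.2).trans (hball.trans subset_closure))
          · obtain ⟨ρ, hρ⟩ := hΩ.exists_isDefiningFunction
              (hΩ.isOpen.frontier_eq ▸ ⟨hx₀, hxΩ⟩ : x₀ ∈ frontier Ω)
            exact hρ.exists_edist_le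
        refine ⟨closure Ω ∩ Metric.ball x₀ (r / 2), inter_mem_nhdsWithin _
          (Metric.ball_mem_nhds x₀ (by positivity)), L, r / 2, by positivity,
          fun F _ _ g hg x hx y hy hxy => ?_⟩
        have hx2 := Metric.mem_ball.1 hx.2
        refine h F g hg x ⟨hx.1, Metric.mem_ball.2 (by linarith)⟩ y ⟨hy, Metric.mem_ball.2 ?_⟩
        linarith [dist_triangle_left y x₀ x]
    -- Pairs of distant points are handled by the supremum of the function.
    refine ⟨L + Real.toNNReal (2 / δ), fun F _ _ g hg x hx y hy => ?_⟩
    by_cases hxy : dist x y < δ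
    · refine (hL F g hg x hx y hy hxy).trans ?_
      gcongr
      · exact le_self_add
      · exact le_add_self
    · have h1 : (1 : ℝ≥0∞) ≤ ENNReal.ofReal (1 / δ) * edist x y := by
        rw [edist_dist, ← ENNReal.ofReal_mul (by positivity), ← ENNReal.ofReal_one]
        refine ENNReal.ofReal_le_ofReal ?_
        rw [div_mul_eq_mul_div, one_mul, one_le_div hδ]
        exact not_lt.1 hxy
      have h2 : edist (g x) (g y) ≤ 2 * supENorm (closure Ω) g := by
        rw [edist_eq_enorm_sub, two_mul]
        exact (enorm_sub_le).trans
          (add_le_add (enorm_le_supENorm g hx) (enorm_le_supENorm g hy))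
      have h3 : ((Real.toNNReal (2 / δ) : ℝ≥0) : ℝ≥0∞) = 2 * ENNReal.ofReal (1 / δ) := by
        rw [← ENNReal.ofReal_ofNat 2, ← ENNReal.ofReal_mul (by norm_num)]
        congr 2
        ring
      push_cast
      rw [h3]
      calc edist (g x) (g y) ≤ 2 * supENorm (closure Ω) g * 1 := by rwa [mul_one]
        _ ≤ 2 * supENorm (closure Ω) g * (ENNReal.ofReal (1 / δ) * edist x y) := by gcongr
        _ = (2 * ENNReal.ofReal (1 / δ)) * supENorm (closure Ω) g * edist x y := by ring
        _ ≤ _ := by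
          gcongr
          · exact le_add_self
          · exact le_self_add

theorem IsDefiningFunction.fderiv_eq_zero_of_mem_boundaryTangent (h : IsDefiningFunction Ω x₀ ρ)
    {v : Eu d} (hv : v ∈ boundaryTangent Ω x₀) : fderiv ℝ ρ x₀ v = 0 := by
  obtain ⟨r, hr, hcl⟩ := h.exists_ball_mem_closure_iff
  have h0 : ∀ᶠ x in 𝓝[frontier Ω] x₀, ρ x = 0 := by
    filter_upwards [self_mem_nhdsWithin, mem_nhdsWithin_of_mem_nhds (Metric.ball_mem_nhds x₀ hr),
      mem_nhdsWithin_of_mem_nhds h.eventually] with x hx hxr hxΩ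
    rw [h.isOpen.frontier_eq] at hx
    exact le_antisymm ((hcl x hxr).1 hx.1) (not_lt.1 fun h2 => hx.2 (hxΩ.2 h2))
  have h1 : HasFDerivWithinAt ρ (0 : Eu d →L[ℝ] ℝ) (frontier Ω) x₀ :=
    (hasFDerivWithinAt_const (0 : ℝ) x₀ _).congr_of_eventuallyEq h0 h.apply_eq_zero
  have h2 : HasFDerivWithinAt ρ (fderiv ℝ ρ x₀) (frontier Ω) x₀ :=
    (h.contDiff.differentiable (by simp) x₀).hasFDerivAt.hasFDerivWithinAt
  have h3 : boundaryTangent Ω x₀ ≤ LinearMap.ker (fderiv ℝ ρ x₀ : Eu d →ₗ[ℝ] ℝ) :=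
    Submodule.span_le.2 fun w hw => h2.unique_on h1 hw
  exact h3 hv

/-- The differential of a map that fixes the boundary is the identity on tangent vectors. -/
theorem fderivWithin_apply_of_mem_boundaryTangent {Φ : Eu d → Eu d}
    (hd : DifferentiableWithinAt ℝ Φ (closure Ω) x₀) (hid : ∀ x ∈ frontier Ω, Φ x = x)
    (hx₀ : x₀ ∈ frontier Ω) {v : Eu d} (hv : v ∈ boundaryTangent Ω x₀) :
    fderivWithin ℝ Φ (closure Ω) x₀ v = v := by
  have h1 := hd.hasFDerivWithinAt.mono (frontier_subset_closure (s := Ω))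
  have h2 : HasFDerivWithinAt Φ (ContinuousLinearMap.id ℝ (Eu d)) (frontier Ω) x₀ :=
    (hasFDerivWithinAt_id x₀ _).congr hid (hid x₀ hx₀)
  have h3 : boundaryTangent Ω x₀ ≤ LinearMap.eqLocus
      (fderivWithin ℝ Φ (closure Ω) x₀ : Eu d →ₗ[ℝ] Eu d) LinearMap.id :=
    Submodule.span_le.2 fun w hw => h1.unique_on h2 hw
  exact h3 hv

/-- Let `L` be the differential at a boundary point of a map of `closure Ω` to itself that fixes
the boundary. As `L` is the identity on tangent vectors and does not turn inward vectors into
outward ones, its determinant is nonnegative when the tangent space is a hyperplane. The forms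
`v ⌟ dx¹ ∧ ⋯ ∧ dxⁿ` and `L v ⌟ dx¹ ∧ ⋯ ∧ dxⁿ` then agree on tangent vectors up to the factor
`|det L|`. Independent tangent vectors `t₁, …, t_d` can only exist in the hyperplane case. -/
theorem volForm_fderivWithin_apply (hΩ : IsSmoothBoundedDomain Ω) {Φ : Eu d → Eu d}
    (hd : DifferentiableWithinAt ℝ Φ (closure Ω) x₀) (hmaps : MapsTo Φ (closure Ω) (closure Ω))
    (hid : ∀ x ∈ frontier Ω, Φ x = x) (hx₀ : x₀ ∈ frontier Ω) (v : Eu d) (t : Fin d → Eu d)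
    (ht : ∀ i, t i ∈ boundaryTangent Ω x₀) :
    volForm d (Matrix.vecCons (fderivWithin ℝ Φ (closure Ω) x₀ v) t) =
      |LinearMap.det (fderivWithin ℝ Φ (closure Ω) x₀ : Eu d →ₗ[ℝ] Eu d)| *
        volForm d (Matrix.vecCons v t) := by
  set L := fderivWithin ℝ Φ (closure Ω) x₀ with hL
  have hLt : ∀ i, L (t i) = t i := fun i =>
    fderivWithin_apply_of_mem_boundaryTangent hd hid hx₀ (ht i)
  by_cases hind : LinearIndependent ℝ t
  swap
  · have hdep : ∀ w : Eu d, volForm d (Matrix.vecCons w t) = 0 := fun w =>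
      (volForm d).map_linearDependent _ fun h => hind (linearIndependent_finCons.1 h).1
    rw [hdep, hdep, mul_zero]
  obtain ⟨ρ, hρ⟩ := hΩ.exists_isDefiningFunction hx₀
  obtain ⟨e, he⟩ := hρ.exists_inward
  set ℓ : Eu d →ₗ[ℝ] ℝ := (fderiv ℝ ρ x₀ : Eu d →ₗ[ℝ] ℝ) with hℓ
  have hℓe : ℓ e = -1 := he
  have hℓt : ∀ i, ℓ (t i) = 0 := fun i => hρ.fderiv_eq_zero_of_mem_boundaryTangent (ht i)
  have hspan : Submodule.span ℝ (range t) = LinearMap.ker ℓ := by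
    refine Submodule.eq_of_le_of_finrank_eq (Submodule.span_le.2 ?_) ?_
    · rintro _ ⟨i, rfl⟩
      exact hℓt i
    · have hsurj : LinearMap.range ℓ = ⊤ := LinearMap.range_eq_top.2 fun c =>
        ⟨-c • e, by rw [map_smul, hℓe]; simp⟩
      have h1 := LinearMap.finrank_range_add_finrank_ker ℓ
      rw [hsurj, finrank_top, Module.finrank_self, finrank_euclideanSpace_fin] at h1
      rw [finrank_span_eq_card hind, Fintype.card_fin]
      omega
  have hker : ∀ w, ℓ w = 0 → L w = w := by
    intro w hw
    have h1 : Submodule.span ℝ (range t) ≤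
        LinearMap.eqLocus (L : Eu d →ₗ[ℝ] Eu d) LinearMap.id := by
      refine Submodule.span_le.2 ?_
      rintro _ ⟨i, rfl⟩
      exact hLt i
    exact h1 (hspan ▸ hw)
  have htrans : (L : Eu d →ₗ[ℝ] Eu d) = LinearMap.transvection ℓ (e - L e) := by
    ext1 w
    have h1 := hker (w + ℓ w • e) (by rw [map_add, map_smul, hℓe]; simp)
    rw [map_add, map_smul] at h1
    rw [LinearMap.transvection.apply, smul_sub, ContinuousLinearMap.coe_coe, ← add_sub_assoc, ← h1]
    abel
  have hdet : LinearMap.det (L : Eu d →ₗ[ℝ] Eu d) = -ℓ (L e) := by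
    rw [htrans, LinearMap.transvection.det, map_sub, hℓe]
    ring
  have hmax : IsLocalMaxOn (ρ ∘ Φ) (closure Ω) x₀ := by
    obtain ⟨r, hr, hcl⟩ := hρ.exists_ball_mem_closure_iff
    have hcont : Tendsto Φ (𝓝[closure Ω] x₀) (𝓝 x₀) := by
      simpa only [ContinuousWithinAt, hid x₀ hx₀] using hd.continuousWithinAt
    filter_upwards [self_mem_nhdsWithin, hcont (Metric.ball_mem_nhds x₀ hr)] with x hx hxr
    simp only [Function.comp_apply, hid x₀ hx₀, hρ.apply_eq_zero]
    exact (hcl _ hxr).1 (hmaps hx)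
  have hneg : ℓ (L e) ≤ 0 := by
    have h1 : HasFDerivWithinAt (ρ ∘ Φ) ((fderiv ℝ ρ x₀).comp L) (closure Ω) x₀ := by
      refine HasFDerivAt.comp_hasFDerivWithinAt x₀ ?_ hd.hasFDerivWithinAt
      rw [hid x₀ hx₀]
      exact (hρ.contDiff.differentiable (by simp) x₀).hasFDerivAt
    have h2 : (fderiv ℝ ρ x₀).comp L e ≤ 0 :=
      hmax.hasFDerivWithinAt_nonpos h1 (hρ.mem_posTangentConeAt he)
    exact h2
  rw [abs_of_nonneg (hdet ▸ neg_nonneg.2 hneg)]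
  have h1 : Matrix.vecCons (L v) t = (L : Eu d →ₗ[ℝ] Eu d) ∘ Matrix.vecCons v t := by
    ext1 i
    refine Fin.cases ?_ (fun i => ?_) i
    · simp
    · simp [hLt]
  rw [h1, volForm, Module.Basis.det_comp]

end BoundaryGeometry

/-! ### The Piola identity -/

section Piola

variable {E : Type} [NormedAddCommGroup E] [NormedSpace ℝ E] {n : Type} [Fintype n] [DecidableEq n]
  {A : E → Matrix n n ℝ} {y : E}

/-- The determinant, as a continuous multilinear function of the rows. -/
noncomputable def detRowContinuous (n : Type) [Fintype n] [DecidableEq n] :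
    ContinuousMultilinearMap ℝ (fun _ : n => n → ℝ) ℝ :=
  { (Matrix.detRowAlternating : (n → ℝ) [⋀^n]→ₗ[ℝ] ℝ).toMultilinearMap with
    cont := by
      have : Continuous fun M : Matrix n n ℝ => M.det := Continuous.matrix_det continuous_id
      exact this }

/-- The derivative of an entry of the adjugate: one row of `A` is replaced by a basis vector, and
the other rows are differentiated one at a time. -/
theorem hasFDerivAt_adjugate (hA : ∀ m l, DifferentiableAt ℝ (fun z => A z m l) y) (i k : n) :
    ∃ D : E →L[ℝ] ℝ, HasFDerivAt (fun z => (A z).adjugate i k) D y ∧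
      ∀ v, D v = ∑ m, if m = k then 0 else
        ((A y).updateRow k (Pi.single i 1)).updateRow m
          (fun l => fderiv ℝ (fun z => A z m l) y v) |>.det := by
  set g' : n → E →L[ℝ] (n → ℝ) := fun m => if m = k then 0 else
    ContinuousLinearMap.pi fun l => fderiv ℝ (fun z => A z m l) y with hg'
  have hg : ∀ m, HasFDerivAt (fun z => (A z).updateRow k (Pi.single i 1) m) (g' m) y := by
    intro m
    by_cases hm : m = k
    · subst hm
      simp only [Matrix.updateRow_self, hg', if_true]
      exact hasFDerivAt_const _ _
    · simp only [Matrix.updateRow_ne hm, hg', if_neg hm]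
      exact hasFDerivAt_pi.2 fun l => (hA m l).hasFDerivAt
  have h := HasFDerivAt.multilinear_comp (detRowContinuous n) hg
  refine ⟨_, h.congr_of_eventuallyEq (.of_forall fun z => Matrix.adjugate_apply _ _ _),
    fun v => ?_⟩
  · rw [sum_apply]
    refine Finset.sum_congr rfl fun m _ => ?_
    have e : ((detRowContinuous n).toContinuousLinearMap
        (fun j => (A y).updateRow k (Pi.single i 1) j) m ∘L g' m) v =
        (((A y).updateRow k (Pi.single i 1)).updateRow m (g' m v)).det := rfl
    rw [e]
    by_cases hm : m = k
    · rw [if_pos hm]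
      refine Matrix.det_eq_zero_of_row_eq_zero m fun j => ?_
      simp [hg', hm]
    · rw [if_neg hm]
      simp only [hg', if_neg hm]
      rfl

/-- The Piola identity: the cofactor matrix of a Jacobian matrix is divergence free. The symmetry
of second derivatives makes the terms of the divergence cancel in pairs, since exchanging two rows
changes the sign of a determinant. -/
theorem sum_fderiv_adjugate_eq_zero {e : n → E}
    (hA : ∀ m l, DifferentiableAt ℝ (fun z => A z m l) y)
    (hsymm : ∀ k m l, fderiv ℝ (fun z => A z m l) y (e k) = fderiv ℝ (fun z => A z k l) y (e m))
    (i : n) : ∑ k, fderiv ℝ (fun z => (A z).adjugate i k) y (e k) = 0 := by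
  set T : n → n → ℝ := fun k m => if m = k then 0 else
        (((A y).updateRow k (Pi.single i 1)).updateRow m
          (fun l => fderiv ℝ (fun z => A z m l) y (e k))).det with hT
  have h1 : ∀ k, fderiv ℝ (fun z => (A z).adjugate i k) y (e k) = ∑ m, T k m := fun k => by
    obtain ⟨D, hD, hDv⟩ := hasFDerivAt_adjugate hA i k
    rw [hD.fderiv, hDv]
  have h2 : ∀ k m, T k m = -T m k := by
    intro k m
    by_cases hm : m = k
    · simp [hT, hm]
    · have hm' : k ≠ m := fun h => hm h.symm
      simp only [hT, if_neg hm, if_neg hm']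
      refine Eq.trans (congrArg Matrix.det ?_)
        ((Matrix.detRowAlternating : (n → ℝ) [⋀^n]→ₗ[ℝ] ℝ).map_swap _ hm')
      funext j
      change _ = ((A y).updateRow m (Pi.single i 1)).updateRow k
        (fun l => fderiv ℝ (fun z => A z k l) y (e m)) (Equiv.swap k m j)
      by_cases hjk : j = k
      · subst hjk
        simp [Matrix.updateRow_ne hm', Matrix.updateRow_self, Matrix.updateRow_ne hm]
      · by_cases hjm : j = m
        · subst hjm
          simp [Matrix.updateRow_self, hsymm]
        · simp [Equiv.swap_apply_of_ne_of_ne hjk hjm, Matrix.updateRow_ne hjk,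
            Matrix.updateRow_ne hjm]
  simp only [h1]
  have h3 : ∑ k, ∑ m, T k m = -∑ k, ∑ m, T k m := by
    conv_rhs => rw [Finset.sum_comm]
    simp only [← Finset.sum_neg_distrib, ← h2]
  linarith

end Piola

/-! ### The flux in coordinates -/

section Coordinates

variable {d : ℕ}

theorem apply_eq_sum_coordVec {F : Type} [NormedAddCommGroup F] [NormedSpace ℝ F]
    (L : Eu d →L[ℝ] F) (v : Eu d) : L v = ∑ l, v l • L (coordVec l) := by
  have h : v = ∑ l, v l • coordVec l := by
    ext i
    simp [coordVec, Pi.single_apply]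
  conv_lhs => rw [h, map_sum]
  simp

/-- The divergence of the Piola transform `adj(DΨ)ᵀ (F ∘ Ψ)` is `det DΨ ⬝ (div F) ∘ Ψ`. -/
theorem sum_fderiv_adjugate_mul_comp {A : Eu d → Matrix (Fin (d + 1)) (Fin (d + 1)) ℝ}
    {Ψ : Eu d → Eu d} {y : Eu d} {F : Eu d → Fin (d + 1) → ℝ} (hΨ : DifferentiableAt ℝ Ψ y)
    (hAΨ : ∀ k l, A y k l = fderiv ℝ Ψ y (coordVec k) l)
    (hA : ∀ m l, DifferentiableAt ℝ (fun z => A z m l) y)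
    (hsymm : ∀ k m l, fderiv ℝ (fun z => A z m l) y (coordVec k) =
      fderiv ℝ (fun z => A z k l) y (coordVec m))
    (hF : ∀ i, DifferentiableAt ℝ (fun x => F x i) (Ψ y)) :
    (∀ k, DifferentiableAt ℝ (fun z => ∑ i, (A z).adjugate i k * F (Ψ z) i) y) ∧
    ∑ k, fderiv ℝ (fun z => ∑ i, (A z).adjugate i k * F (Ψ z) i) y (coordVec k) =
      (A y).det * ∑ i, fderiv ℝ (fun x => F x i) (Ψ y) (coordVec i) := by
  have hadj : ∀ i k, DifferentiableAt ℝ (fun z => (A z).adjugate i k) y := fun i k => by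
    obtain ⟨D, hD, -⟩ := hasFDerivAt_adjugate hA i k
    exact hD.differentiableAt
  have hcomp : ∀ i, HasFDerivAt (fun z => F (Ψ z) i)
      ((fderiv ℝ (fun x => F x i) (Ψ y)).comp (fderiv ℝ Ψ y)) y := fun i =>
    (hF i).hasFDerivAt.comp y hΨ.hasFDerivAt
  have hder : ∀ k, HasFDerivAt (fun z => ∑ i, (A z).adjugate i k * F (Ψ z) i)
      (∑ i, ((A y).adjugate i k • (fderiv ℝ (fun x => F x i) (Ψ y)).comp (fderiv ℝ Ψ y) +
        F (Ψ y) i • fderiv ℝ (fun z => (A z).adjugate i k) y)) y := fun k =>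
    HasFDerivAt.fun_sum fun i _ => (hadj i k).hasFDerivAt.mul (hcomp i)
  refine ⟨fun k => (hder k).differentiableAt, ?_⟩
  have h1 : ∀ k, fderiv ℝ (fun z => ∑ i, (A z).adjugate i k * F (Ψ z) i) y (coordVec k) =
      ∑ i, ((∑ l, (A y).adjugate i k * A y k l * fderiv ℝ (fun x => F x i) (Ψ y) (coordVec l)) +
        F (Ψ y) i * fderiv ℝ (fun z => (A z).adjugate i k) y (coordVec k)) := by
    intro k
    rw [(hder k).fderiv, sum_apply]
    refine Finset.sum_congr rfl fun i _ => ?_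
    rw [add_apply, smul_apply, smul_apply,
      ContinuousLinearMap.comp_apply, apply_eq_sum_coordVec _ (fderiv ℝ Ψ y (coordVec k)),
      smul_eq_mul, smul_eq_mul, Finset.mul_sum]
    congr 1
    refine Finset.sum_congr rfl fun l _ => ?_
    rw [hAΨ, smul_eq_mul, mul_assoc]
  have h2 : ∀ i l, ∑ k, (A y).adjugate i k * A y k l = if i = l then (A y).det else 0 := by
    intro i l
    rw [← Matrix.mul_apply, Matrix.adjugate_mul, Matrix.smul_apply, Matrix.one_apply]
    simp
  simp only [h1]
  rw [Finset.sum_comm, Finset.mul_sum]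
  refine Finset.sum_congr rfl fun i _ => ?_
  rw [Finset.sum_add_distrib, ← Finset.mul_sum, sum_fderiv_adjugate_eq_zero hA hsymm, mul_zero,
    add_zero, Finset.sum_comm]
  simp only [← Finset.sum_mul, h2, ite_mul, zero_mul]
  simp

theorem gradientWithin_apply (u : Eu d → ℝ) (s : Set (Eu d)) (x : Eu d) (i : Fin (d + 1)) :
    gradientWithin u s x i = fderivWithin ℝ u s x (coordVec i) := by
  rw [← toDual_gradientWithin, InnerProductSpace.toDual_apply_apply, coordVec,
    EuclideanSpace.inner_single_right]
  simp

theorem flux_eq_mulVec (Ω : Set (Eu d)) (γ : Coeff d) (u : Eu d → ℝ) (x : Eu d) :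
    flux Ω γ u x = γ (u x) x (gradientWithin u (closure Ω) x) *ᵥ
      (gradientWithin u (closure Ω) x).ofLp := rfl

theorem det_jacobian (Ω : Set (Eu d)) (Φ : Eu d → Eu d) (x : Eu d) :
    (jacobian Ω Φ x).det =
      LinearMap.det (fderivWithin ℝ Φ (closure Ω) x : Eu d →ₗ[ℝ] Eu d) := by
  rw [← LinearMap.det_toMatrix (EuclideanSpace.basisFun (Fin (d + 1)) ℝ).toBasis,
    ← Matrix.det_transpose]
  congr 1

end Coordinates

/-! ### Diffeomorphisms and the gauge transform -/

section Diffeo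

variable {d : ℕ} {Ω : Set (Eu d)} {α : ℝ≥0} {Φ : PartialEquiv (Eu d) (Eu d)}

namespace IsHolderDiffeo

theorem symm (hΦ : IsHolderDiffeo Ω α Φ) : IsHolderDiffeo Ω α Φ.symm :=
  ⟨hΦ.target_eq, hΦ.source_eq, hΦ.regular_symm, hΦ.regular⟩

theorem mapsTo (hΦ : IsHolderDiffeo Ω α Φ) : MapsTo Φ (closure Ω) (closure Ω) := by
  have := Φ.mapsTo
  rwa [hΦ.source_eq, hΦ.target_eq] at this

theorem left_inv (hΦ : IsHolderDiffeo Ω α Φ) {x : Eu d} (hx : x ∈ closure Ω) :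
    Φ.symm (Φ x) = x := Φ.left_inv (hΦ.source_eq ▸ hx)

theorem right_inv (hΦ : IsHolderDiffeo Ω α Φ) {y : Eu d} (hy : y ∈ closure Ω) :
    Φ (Φ.symm y) = y := hΦ.symm.left_inv hy

theorem differentiableOn (hΦ : IsHolderDiffeo Ω α Φ) : DifferentiableOn ℝ Φ (closure Ω) :=
  hΦ.regular.1.differentiableOn (by simp)

theorem symm_eq_self (hΦ : IsHolderDiffeo Ω α Φ) (hid : ∀ x ∈ frontier Ω, Φ x = x) :
    ∀ x ∈ frontier Ω, Φ.symm x = x := fun x hx => by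
  conv_lhs => rw [← hid x hx]
  exact hΦ.left_inv (frontier_subset_closure hx)

/-- A bijection of `closure Ω` that fixes the boundary maps `Ω` to itself. -/
theorem mapsTo_interior (hΦ : IsHolderDiffeo Ω α Φ) (hΩ : IsOpen Ω)
    (hid : ∀ x ∈ frontier Ω, Φ x = x) : MapsTo Φ Ω Ω := fun x hx => by
  by_contra hn
  have hxc := subset_closure hx
  have hf : Φ x ∈ frontier Ω := hΩ.frontier_eq ▸ ⟨hΦ.mapsTo hxc, hn⟩
  have h1 : Φ x = x := by
    rw [← hΦ.left_inv (hΦ.mapsTo hxc), hid _ hf, hΦ.left_inv hxc]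
  exact hn (h1.symm ▸ hx)

/-- The chain rule for `Φ⁻¹ ∘ Φ = id`. -/
theorem jacobian_mul_jacobian_symm (hΦ : IsHolderDiffeo Ω α Φ) (hu : UniqueDiffOn ℝ (closure Ω))
    {x : Eu d} (hx : x ∈ closure Ω) :
    jacobian Ω Φ x * jacobian Ω Φ.symm (Φ x) = 1 := by
  have h1 : fderivWithin ℝ (Φ.symm ∘ Φ) (closure Ω) x =
      (fderivWithin ℝ Φ.symm (closure Ω) (Φ x)).comp (fderivWithin ℝ Φ (closure Ω) x) :=
    fderivWithin_comp x (hΦ.symm.differentiableOn _ (hΦ.mapsTo hx)) (hΦ.differentiableOn x hx)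
      hΦ.mapsTo (hu x hx)
  have h2 : fderivWithin ℝ (Φ.symm ∘ Φ) (closure Ω) x = ContinuousLinearMap.id ℝ (Eu d) := by
    rw [fderivWithin_congr (f := id) (f₁ := Φ.symm ∘ Φ) (fun z hz => hΦ.left_inv hz)
      (hΦ.left_inv hx),
      fderivWithin_id (hu x hx)]
  ext i k
  have h3 := congrArg (fun L : Eu d →L[ℝ] Eu d => L (coordVec i) k) (h1.symm.trans h2)
  simp only [ContinuousLinearMap.comp_apply, ContinuousLinearMap.id_apply] at h3
  rw [apply_eq_sum_coordVec] at h3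
  simp only [Matrix.mul_apply, jacobian, Matrix.of_apply, Matrix.one_apply]
  simpa [coordVec, Pi.single_apply, eq_comm] using h3

theorem jacobian_symm_mul_jacobian (hΦ : IsHolderDiffeo Ω α Φ) (hu : UniqueDiffOn ℝ (closure Ω))
    {y : Eu d} (hy : y ∈ closure Ω) :
    jacobian Ω Φ.symm y * jacobian Ω Φ (Φ.symm y) = 1 :=
  hΦ.symm.jacobian_mul_jacobian_symm hu hy

theorem jacobian_mul_jacobian_symm' (hΦ : IsHolderDiffeo Ω α Φ) (hu : UniqueDiffOn ℝ (closure Ω))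
    {y : Eu d} (hy : y ∈ closure Ω) :
    jacobian Ω Φ (Φ.symm y) * jacobian Ω Φ.symm y = 1 :=
  mul_eq_one_comm.1 (hΦ.jacobian_symm_mul_jacobian hu hy)

/-- The gauge transforms by `Φ` and by `Φ⁻¹` are inverse to each other. -/
theorem gaugeTransform_symm_gaugeTransform (hΦ : IsHolderDiffeo Ω α Φ)
    (hu : UniqueDiffOn ℝ (closure Ω)) (γ : Coeff d) (s : ℝ) {x : Eu d} (hx : x ∈ closure Ω)
    (p : Eu d) :
    gaugeTransform Ω Φ.symm (gaugeTransform Ω Φ γ) s x p = γ s x p := by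
  have hJB := hΦ.jacobian_mul_jacobian_symm hu hx
  simp only [gaugeTransform, PartialEquiv.symm_symm, hΦ.left_inv hx]
  set J := jacobian Ω Φ x
  set B := jacobian Ω Φ.symm (Φ x)
  have hdet : |B.det|⁻¹ * |J.det|⁻¹ = 1 := by
    rw [← mul_inv, ← abs_mul, mul_comm, ← Matrix.det_mul, hJB]
    simp
  rw [Matrix.mulVec_mulVec, hJB, Matrix.one_mulVec, Matrix.mul_smul, Matrix.smul_mul, smul_smul,
    hdet, one_smul]
  have e : Bᵀ * (Jᵀ * γ s x p * J) * B = (J * B)ᵀ * γ s x p * (J * B) := by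
    simp only [Matrix.transpose_mul, Matrix.mul_assoc]
  rw [e, hJB]
  simp

/-- The flux for the transformed coefficients is the push-forward of the flux, as a vector
density. -/
theorem flux_gaugeTransform (hΦ : IsHolderDiffeo Ω α Φ) (hu : UniqueDiffOn ℝ (closure Ω))
    (γ : Coeff d) {u : Eu d → ℝ} (hdu : DifferentiableOn ℝ u (closure Ω)) {y : Eu d}
    (hy : y ∈ closure Ω) :
    flux Ω (gaugeTransform Ω Φ γ) (u ∘ Φ.symm) y =
      |(jacobian Ω Φ (Φ.symm y)).det|⁻¹ •
        ((jacobian Ω Φ (Φ.symm y))ᵀ *ᵥ flux Ω γ u (Φ.symm y)) := by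
  have hgrad : (gradientWithin (u ∘ Φ.symm) (closure Ω) y).ofLp =
      jacobian Ω Φ.symm y *ᵥ (gradientWithin u (closure Ω) (Φ.symm y)).ofLp := by
    ext i
    rw [gradientWithin_apply, fderivWithin_comp y (hdu _ (hΦ.symm.mapsTo hy))
      (hΦ.symm.differentiableOn y hy) hΦ.symm.mapsTo (hu y hy), ContinuousLinearMap.comp_apply,
      apply_eq_sum_coordVec]
    refine Finset.sum_congr rfl fun l _ => ?_
    rw [gradientWithin_apply, smul_eq_mul]
    rfl
  have hJA := hΦ.jacobian_mul_jacobian_symm' hu hy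
  rw [flux_eq_mulVec, flux_eq_mulVec]
  simp only [gaugeTransform]
  rw [hgrad]
  set J := jacobian Ω Φ (Φ.symm y)
  set A := jacobian Ω Φ.symm y
  rw [Matrix.smul_mulVec, Matrix.mulVec_mulVec, Matrix.mulVec_mulVec, Matrix.mulVec_mulVec, hJA,
    Matrix.one_mulVec, Matrix.mul_assoc, hJA, Matrix.mul_one]
  rfl

end IsHolderDiffeo

end Diffeo

/-! ### Invariance of solutions and of Neumann data -/

section GaugeInvariance

open Filter Topology

variable {d : ℕ} {Ω : Set (Eu d)} {α : ℝ≥0} {Φ : PartialEquiv (Eu d) (Eu d)} {γ : Coeff d}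

theorem closure_mem_nhds (hΩ : IsOpen Ω) {x : Eu d} (hx : x ∈ Ω) : closure Ω ∈ 𝓝 x :=
  mem_of_superset (hΩ.mem_nhds hx) subset_closure

/-- The entries of the Jacobian matrix of a `C²` map are differentiable, and its rows satisfy the
compatibility conditions given by the symmetry of second derivatives. -/
theorem jacobian_differentiableAt_and_symm (hΩ : IsOpen Ω) {Ψ : Eu d → Eu d}
    (hΨ : ContDiffOn ℝ 2 Ψ (closure Ω)) {y : Eu d} (hy : y ∈ Ω) :
    (∀ m l, DifferentiableAt ℝ (fun z => jacobian Ω Ψ z m l) y) ∧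
    ∀ k m l, fderiv ℝ (fun z => jacobian Ω Ψ z m l) y (coordVec k) =
      fderiv ℝ (fun z => jacobian Ω Ψ z k l) y (coordVec m) := by
  have hc : ContDiffAt ℝ 2 Ψ y := hΨ.contDiffAt (closure_mem_nhds hΩ hy)
  have hd : DifferentiableAt ℝ (fderiv ℝ Ψ) y :=
    (hc.fderiv_right (m := 1) (by norm_num)).differentiableAt (by simp)
  have heq : ∀ m l, (fun z => jacobian Ω Ψ z m l) =ᶠ[𝓝 y]
      fun z => EuclideanSpace.proj (𝕜 := ℝ) l (fderiv ℝ Ψ z (coordVec m)) := fun m l => by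
    filter_upwards [hΩ.mem_nhds hy] with z hz
    simp only [jacobian, Matrix.of_apply, fderivWithin_of_mem_nhds (closure_mem_nhds hΩ hz)]
    rfl
  have hder : ∀ m l, HasFDerivAt (fun z => jacobian Ω Ψ z m l)
      ((EuclideanSpace.proj (𝕜 := ℝ) l).comp ((fderiv ℝ (fderiv ℝ Ψ) y).flip (coordVec m))) y :=
    fun m l => by
      refine HasFDerivAt.congr_of_eventuallyEq ?_ (heq m l)
      refine (EuclideanSpace.proj (𝕜 := ℝ) l).hasFDerivAt.comp y ?_
      have := hd.hasFDerivAt.clm_apply (hasFDerivAt_const (coordVec m) y)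
      simpa using this
  refine ⟨fun m l => (hder m l).differentiableAt, fun k m l => ?_⟩
  rw [(hder m l).fderiv, (hder k l).fderiv]
  have hs := hc.isSymmSndFDerivAt (by simp) (coordVec k) (coordVec m)
  simp only [ContinuousLinearMap.comp_apply, ContinuousLinearMap.flip_apply, hs]

/-- Solutions are carried to solutions of the transformed equation. -/
theorem IsSolution.comp_symm (hΩ : IsSmoothBoundedDomain Ω) (hα : α ≤ 1)
    (hΦ : IsHolderDiffeo Ω α Φ) (hid : ∀ x ∈ frontier Ω, Φ x = x) {f : frontier Ω → ℝ}
    {u : Eu d → ℝ} (hu : IsSolution Ω α γ f u) :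
    IsSolution Ω α (gaugeTransform Ω Φ γ) f (u ∘ Φ.symm) := by
  have hL := hΩ.isLipschitzDomain
  have hud := hL.uniqueDiffOn
  have hdu : DifferentiableOn ℝ u (closure Ω) := hu.regular.1.differentiableOn (by simp)
  set A := jacobian Ω Φ.symm with hAdef
  have key : ∀ y ∈ Ω, ∃ ε : ℝ, ∀ k, (fun z => flux Ω (gaugeTransform Ω Φ γ) (u ∘ Φ.symm) z k)
      =ᶠ[𝓝 y] fun z => ε * ∑ i, (A z).adjugate i k * flux Ω γ u (Φ.symm z) i := by
    intro y hy
    have hA := (jacobian_differentiableAt_and_symm hΩ.isOpen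
      (hΦ.regular_symm.1.of_le (by norm_num)) hy).1
    have hdet : ContinuousAt (fun z => (A z).det) y := by
      have h1 : ContinuousAt A y :=
        continuousAt_pi.2 fun m => continuousAt_pi.2 fun l => (hA m l).continuousAt
      exact (Continuous.matrix_det continuous_id).continuousAt.comp h1
    have hA0 : (A y).det ≠ 0 := fun h0 => by
      have := congrArg Matrix.det (hΦ.jacobian_symm_mul_jacobian hud (subset_closure hy))
      rw [Matrix.det_mul, Matrix.det_one] at this
      rw [hAdef] at h0
      rw [h0, zero_mul] at this
      exact zero_ne_one this
    -- The sign of the determinant is locally constant.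
    obtain ⟨ε, hε⟩ : ∃ ε : ℝ, ∀ᶠ z in 𝓝 y, ε * (A z).det = |(A z).det| := by
      rcases lt_or_gt_of_ne hA0 with h | h
      · refine ⟨-1, (hdet.eventually_lt continuousAt_const h).mono fun z hz => ?_⟩
        rw [abs_of_neg hz, neg_one_mul]
      · refine ⟨1, (continuousAt_const.eventually_lt hdet h).mono fun z hz => ?_⟩
        rw [abs_of_pos hz, one_mul]
    refine ⟨ε, fun k => ?_⟩
    filter_upwards [hε, hΩ.isOpen.mem_nhds hy] with z hz hzΩ
    have hzc := subset_closure hzΩ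
    rw [hΦ.flux_gaugeTransform hud γ hdu hzc]
    have hAJ := hΦ.jacobian_symm_mul_jacobian hud hzc
    rw [← hAdef] at hAJ
    set J := jacobian Ω Φ (Φ.symm z)
    have hadj : (A z).adjugate = (A z).det • J := by
      calc (A z).adjugate = (A z).adjugate * (A z * J) := by rw [hAJ, Matrix.mul_one]
        _ = (A z).det • J := by
          rw [← Matrix.mul_assoc, Matrix.adjugate_mul, Matrix.smul_mul, Matrix.one_mul]
    have hdJ : |J.det|⁻¹ = |(A z).det| := by
      have := congrArg Matrix.det hAJ
      rw [Matrix.det_mul, Matrix.det_one] at this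
      rw [eq_comm, ← abs_inv, ← eq_inv_of_mul_eq_one_left this]
    rw [hdJ, ← hz, Pi.smul_apply, smul_eq_mul, mul_assoc, hadj]
    congr 1
    simp only [Matrix.mulVec, dotProduct, Matrix.transpose_apply, Matrix.smul_apply, smul_eq_mul,
      Finset.mul_sum, mul_assoc]
  have hdiv : ∀ y ∈ Ω, _ := fun y hy =>
    sum_fderiv_adjugate_mul_comp (A := A) (Ψ := Φ.symm) (F := flux Ω γ u) (y := y)
      (hΦ.symm.differentiableOn.differentiableAt (closure_mem_nhds hΩ.isOpen hy))
      (fun k l => by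
        rw [hAdef, jacobian, Matrix.of_apply,
          fderivWithin_of_mem_nhds (closure_mem_nhds hΩ.isOpen hy)])
      (jacobian_differentiableAt_and_symm hΩ.isOpen
        (hΦ.regular_symm.1.of_le (by norm_num)) hy).1
      (jacobian_differentiableAt_and_symm hΩ.isOpen
        (hΦ.regular_symm.1.of_le (by norm_num)) hy).2
      (hu.differentiable _ (hΦ.symm.mapsTo_interior hΩ.isOpen (hΦ.symm_eq_self hid) hy))
  refine ⟨hL.memHolder_comp hα hΦ.symm.mapsTo hΦ.regular_symm hu.regular, fun y hy k => ?_,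
    fun y hy => ?_, fun x => ?_⟩
  · obtain ⟨ε, hε⟩ := key y hy
    exact (((hdiv y hy).1 k).const_mul ε).congr_of_eventuallyEq (hε k)
  · obtain ⟨ε, hε⟩ := key y hy
    have h1 : ∀ k, fderiv ℝ (fun z => flux Ω (gaugeTransform Ω Φ γ) (u ∘ Φ.symm) z k) y
        (coordVec k) = ε * fderiv ℝ (fun z => ∑ i, (A z).adjugate i k *
          flux Ω γ u (Φ.symm z) i) y (coordVec k) := fun k => by
      rw [(hε k).fderiv_eq, fderiv_const_mul ((hdiv y hy).1 k), smul_apply, smul_eq_mul]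
    simp only [h1]
    rw [← Finset.mul_sum, (hdiv y hy).2, hu.equation _
      (hΦ.symm.mapsTo_interior hΩ.isOpen (hΦ.symm_eq_self hid) hy), mul_zero, mul_zero]
  · rw [Function.comp_apply, hΦ.symm_eq_self hid x x.2, hu.boundary]

theorem alternatingMap_sum_apply {M ι κ : Type} [AddCommGroup M] [Module ℝ M] (s : Finset κ)
    (g : κ → M [⋀^ι]→ₗ[ℝ] ℝ) (w : ι → M) : (∑ i ∈ s, g i) w = ∑ i ∈ s, g i w :=
  map_sum (⟨⟨fun φ => φ w, rfl⟩, fun _ _ => rfl⟩ : (M [⋀^ι]→ₗ[ℝ] ℝ) →+ ℝ) g s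

theorem conormalForm_apply (u : Eu d → ℝ) (x : frontier Ω)
    (t : Fin d → boundaryTangent Ω (x : Eu d)) :
    conormalForm Ω γ u x t =
      volForm d (Matrix.vecCons (WithLp.toLp 2 (flux Ω γ u x)) fun i => (t i : Eu d)) := by
  have h : WithLp.toLp 2 (flux Ω γ u x) = ∑ i, flux Ω γ u x i • (coordVec i : Eu d) := by
    ext i
    simp [coordVec, Pi.single_apply]
  change _ = (volForm d).curryLeft (WithLp.toLp 2 (flux Ω γ u x)) fun i => (t i : Eu d)
  rw [h, map_sum, alternatingMap_sum_apply, conormalForm, alternatingMap_sum_apply]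
  refine Finset.sum_congr rfl fun i _ => ?_
  rw [map_smul]
  rfl

/-- The Neumann data of corresponding solutions agree. -/
theorem conormalForm_gaugeTransform (hΩ : IsSmoothBoundedDomain Ω) (hΦ : IsHolderDiffeo Ω α Φ)
    (hid : ∀ x ∈ frontier Ω, Φ x = x) {u : Eu d → ℝ}
    (hdu : DifferentiableOn ℝ u (closure Ω)) :
    conormalForm Ω (gaugeTransform Ω Φ γ) (u ∘ Φ.symm) = conormalForm Ω γ u := by
  have hud := hΩ.isLipschitzDomain.uniqueDiffOn
  funext x
  ext t
  have hxc : (x : Eu d) ∈ closure Ω := frontier_subset_closure x.2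
  rw [conormalForm_apply, conormalForm_apply, hΦ.flux_gaugeTransform hud γ hdu hxc,
    hΦ.symm_eq_self hid x x.2]
  set F := flux Ω γ u x
  have hLF : WithLp.toLp 2 ((jacobian Ω Φ x)ᵀ *ᵥ F) =
      fderivWithin ℝ Φ (closure Ω) x (WithLp.toLp 2 F) := by
    rw [apply_eq_sum_coordVec]
    ext k
    simp [Matrix.mulVec, dotProduct, jacobian, mul_comm]
  have hJ0 : |(jacobian Ω Φ x).det| ≠ 0 := by
    have := congrArg Matrix.det (hΦ.jacobian_mul_jacobian_symm hud hxc)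
    rw [Matrix.det_mul, Matrix.det_one] at this
    exact abs_ne_zero.2 (left_ne_zero_of_mul_eq_one this)
  rw [WithLp.toLp_smul, hLF]
  change (volForm d).curryLeft (_ • _) _ = _
  rw [map_smul, AlternatingMap.smul_apply]
  change _ • volForm d (Matrix.vecCons _ _) = _
  rw [volForm_fderivWithin_apply hΩ (hΦ.differentiableOn x hxc) hΦ.mapsTo hid x.2 _ _
    fun i => (t i).2, ← det_jacobian, smul_eq_mul, inv_mul_cancel_left₀ hJ0]

section Congr

variable {γ₁ γ₂ : Coeff d}

theorem flux_congr (h : ∀ s, ∀ x ∈ closure Ω, ∀ p, γ₁ s x p = γ₂ s x p) (u : Eu d → ℝ)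
    {x : Eu d} (hx : x ∈ closure Ω) : flux Ω γ₁ u x = flux Ω γ₂ u x := by
  rw [flux_eq_mulVec, flux_eq_mulVec, h _ x hx]

theorem IsSolution.congr (hΩ : IsOpen Ω) (h : ∀ s, ∀ x ∈ closure Ω, ∀ p, γ₁ s x p = γ₂ s x p)
    {f : frontier Ω → ℝ} {u : Eu d → ℝ} (hu : IsSolution Ω α γ₁ f u) :
    IsSolution Ω α γ₂ f u := by
  have heq : ∀ x ∈ Ω, ∀ i, (fun y => flux Ω γ₂ u y i) =ᶠ[𝓝 x] fun y => flux Ω γ₁ u y i :=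
    fun x hx i => by
      filter_upwards [closure_mem_nhds hΩ hx] with y hy
      rw [flux_congr h u hy]
  refine ⟨hu.regular, fun x hx i => (hu.differentiable x hx i).congr_of_eventuallyEq (heq x hx i),
    fun x hx => ?_, hu.boundary⟩
  rw [← hu.equation x hx]
  exact Finset.sum_congr rfl fun i _ => by rw [(heq x hx i).fderiv_eq]

theorem IsNeumannDatum.congr (hΩ : IsOpen Ω)
    (h : ∀ s, ∀ x ∈ closure Ω, ∀ p, γ₁ s x p = γ₂ s x p) {f : frontier Ω → ℝ}
    {σ : BoundaryForm Ω} (hσ : IsNeumannDatum Ω α γ₁ f σ) : IsNeumannDatum Ω α γ₂ f σ := by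
  obtain ⟨c, δ, U, S, hS, hf, rfl⟩ := hσ
  refine ⟨c, δ, U, S, ⟨hS.radius_pos, hS.isOpen, hS.const_mem, hS.mem,
    fun g hg => (hS.isSolution g hg).congr hΩ h, fun g hg v hv hsol => hS.unique g hg v hv
      (hsol.congr hΩ fun s x hx p => (h s x hx p).symm), hS.continuous⟩, hf, ?_⟩
  funext x
  simp only [conormalForm, flux_congr h _ (frontier_subset_closure x.2)]

end Congr

theorem exists_pos_mul_lt_ofReal (C : ℝ≥0) {ε : ℝ} (hε : 0 < ε) :
    ∃ η : ℝ, 0 < η ∧ ∀ a : ℝ≥0∞, a < ENNReal.ofReal η → C * a < ENNReal.ofReal ε := by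
  have hC : (0 : ℝ) < C + 1 := by positivity
  refine ⟨ε / (C + 1), by positivity, fun a ha => ?_⟩
  calc (C : ℝ≥0∞) * a ≤ C * ENNReal.ofReal (ε / (C + 1)) := by gcongr
    _ = ENNReal.ofReal (C * (ε / (C + 1))) := by
      rw [ENNReal.ofReal_mul C.coe_nonneg, ENNReal.ofReal_coe_nnreal]
    _ < ENNReal.ofReal ε := by
      rw [ENNReal.ofReal_lt_ofReal_iff hε, mul_div_assoc', div_lt_iff₀ hC]
      linarith

/-- A solution operator `S` near a constant for `γ` yields the solution operator
`f ↦ S f ∘ Φ⁻¹` near the same constant for the transformed coefficients. -/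
theorem IsSolutionOperator.comp_symm (hΩ : IsSmoothBoundedDomain Ω) (hα : α ≤ 1)
    (hΦ : IsHolderDiffeo Ω α Φ) (hid : ∀ x ∈ frontier Ω, Φ x = x) {c δ : ℝ}
    {U : Set (Eu d → ℝ)} {S : (frontier Ω → ℝ) → (Eu d → ℝ)}
    (hS : IsSolutionOperator Ω α γ c δ U S) :
    IsSolutionOperator Ω α (gaugeTransform Ω Φ γ) c δ {v | v ∘ Φ ∈ U}
      (fun f => S f ∘ Φ.symm) := by
  have hL := hΩ.isLipschitzDomain
  refine ⟨hS.radius_pos, ?_, hS.const_mem, fun f hf => ?_,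
    fun f hf => (hS.isSolution f hf).comp_symm hΩ hα hΦ hid, fun f hf v hv hsol => ?_,
    fun f hf ε hε => ?_⟩
  · intro v hv hvm
    obtain ⟨ε, hε, hball⟩ := hS.isOpen _ hv (hL.memHolder_comp hα hΦ.mapsTo hΦ.regular hvm)
    obtain ⟨C, hC⟩ := hL.exists_holderNorm_comp_le hα hΦ.mapsTo 2 hΦ.regular
    obtain ⟨η, hη, hCη⟩ := exists_pos_mul_lt_ofReal C hε
    refine ⟨η, hη, fun w hw hwv => hball _ (hL.memHolder_comp hα hΦ.mapsTo hΦ.regular hw) ?_⟩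
    exact (hC ℝ (w - v) (hw.1.sub hvm.1)).trans_lt (hCη _ hwv)
  · -- `S f ∘ Φ⁻¹ ∘ Φ` and `S f` agree on `closure Ω`, hence lie in the same open sets.
    have heq : EqOn ((S f ∘ Φ.symm) ∘ Φ) (S f) (closure Ω) := fun x hx =>
      congrArg (S f) (hΦ.left_inv hx)
    have hm := (hS.isSolution f hf).regular
    obtain ⟨ε, hε, hball⟩ := hS.isOpen _ (hS.mem f hf) hm
    refine hball _ (hm.congr heq) ?_
    rw [holderNorm_eq_zero_of_eqOn (u := (S f ∘ Φ.symm) ∘ Φ - S f)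
      fun x hx => sub_eq_zero.2 (heq hx)]
    exact ENNReal.ofReal_pos.2 hε
  · have h1 : IsSolution Ω α γ f (v ∘ Φ) :=
      (hsol.comp_symm hΩ hα hΦ.symm (hΦ.symm_eq_self hid)).congr hΩ.isOpen fun s x hx p =>
        hΦ.gaugeTransform_symm_gaugeTransform hL.uniqueDiffOn γ s hx p
    intro y hy
    have h2 := hS.unique f hf _ hv h1 (hΦ.symm.mapsTo hy)
    rwa [Function.comp_apply, hΦ.right_inv hy] at h2
  · obtain ⟨C, hC⟩ := hL.exists_holderNorm_comp_le hα hΦ.symm.mapsTo 2 hΦ.regular_symm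
    obtain ⟨ε', hε', hCε⟩ := exists_pos_mul_lt_ofReal C hε
    obtain ⟨η, hη, hcont⟩ := hS.continuous f hf ε' hε'
    refine ⟨η, hη, fun g hg hgf => ?_⟩
    exact (hC ℝ (S g - S f) ((hS.isSolution g hg).regular.1.sub
      (hS.isSolution f hf).regular.1)).trans_lt (hCε _ (hcont g hg hgf))

/-- Only one implication is proved here; the converse is the same statement for `Φ⁻¹`. -/
theorem IsNeumannDatum.gaugeTransform (hΩ : IsSmoothBoundedDomain Ω) (hα : α ≤ 1)
    (hΦ : IsHolderDiffeo Ω α Φ) (hid : ∀ x ∈ frontier Ω, Φ x = x) {f : frontier Ω → ℝ}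
    {σ : BoundaryForm Ω} (hσ : IsNeumannDatum Ω α γ f σ) :
    IsNeumannDatum Ω α (gaugeTransform Ω Φ γ) f σ := by
  obtain ⟨c, δ, U, S, hS, hf, rfl⟩ := hσ
  exact ⟨c, δ, _, _, hS.comp_symm hΩ hα hΦ hid, hf, (conormalForm_gaugeTransform hΩ hΦ hid
    ((hS.isSolution f hf).regular.1.differentiableOn (by simp))).symm⟩

theorem isNeumannDatum_gaugeTransform_iff (hΩ : IsSmoothBoundedDomain Ω) (hα : α ≤ 1)
    (hΦ : IsHolderDiffeo Ω α Φ) (hid : ∀ x ∈ frontier Ω, Φ x = x) {f : frontier Ω → ℝ}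
    {σ : BoundaryForm Ω} :
    IsNeumannDatum Ω α (gaugeTransform Ω Φ γ) f σ ↔ IsNeumannDatum Ω α γ f σ :=
  ⟨fun h => (h.gaugeTransform hΩ hα hΦ.symm (hΦ.symm_eq_self hid)).congr hΩ.isOpen
    fun s _ hx p => hΦ.gaugeTransform_symm_gaugeTransform hΩ.isLipschitzDomain.uniqueDiffOn
      γ s hx p,
    fun h => h.gaugeTransform hΩ hα hΦ hid⟩

end GaugeInvariance

end QuasilinearDN

theorem mainTheorem8 {d : ℕ} (Ω : Set (QuasilinearDN.Eu d))
    (hΩ : QuasilinearDN.IsSmoothBoundedDomain Ω)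
    (α : ℝ≥0) (hα₀ : 0 < α) (hα₁ : α < 1)
    (γ : QuasilinearDN.Coeff d) (hγ : QuasilinearDN.IsConductivity Ω α γ)
    (Φ : PartialEquiv (QuasilinearDN.Eu d) (QuasilinearDN.Eu d))
    (hΦ : QuasilinearDN.IsHolderDiffeo Ω α Φ)
    (hΦ_id : ∀ x ∈ frontier Ω, Φ x = x) :
    QuasilinearDN.dnMap Ω α (QuasilinearDN.gaugeTransform Ω Φ γ) = QuasilinearDN.dnMap Ω α γ := by
  funext f
  have h : QuasilinearDN.IsNeumannDatum Ω α (QuasilinearDN.gaugeTransform Ω Φ γ) f =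
      QuasilinearDN.IsNeumannDatum Ω α γ f := by
    funext σ
    exact propext (QuasilinearDN.isNeumannDatum_gaugeTransform_iff hΩ hα₁.le hΦ hΦ_id)
  -- The values are obtained by choice from the existence of a unique datum, so they agree as soon
  -- as the two predicates are equal.
  have hpart : ∀ P Q : QuasilinearDN.BoundaryForm Ω → Prop, P = Q →
      (⟨∃! σ, P σ, fun h => h.choose⟩ : Part _) = ⟨∃! σ, Q σ, fun h => h.choose⟩ := by
    rintro P _ rfl
    rfl
  exact hpart _ _ h
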